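/- A **modular ortholattice** (MOL) is a bounded modular lattice $L$ with a map $x\mapsto x'$ satisfying $x\vee x'=1$, $x\wedge x'=0$, $x''=x$, and $x\le y\Rightarrow y'\le x'$. **Projective spaces.** A projective space is a set $P$ of points with a set of 3-element subsets (collinear triplets) such that: if $\{p,s,q\}$ and $\{q,t,r\}$ are collinear, $p\ne r$ and $\{p,q,r\}$ is not collinear, then there is a unique $u$ with $\{p,r,u\}$ and $\{s,t,u\}$ collinear. A subspace is a set $U\subseteq P$ such that $p,q\in U$ and $\{p,q,r\}$ collinear imply $r\in U$; the subspaces form a complete lattice $\mathcal S(P)$ whose meet is intersection and whose join $\sum$ (or $+$) is the subspace generated by the union. An anisotropic orthogonality on $P$ is a symmetric relation $\perp$ on $P$ with $p\not\perp p$ for all $p$, such that $p\perp q$, $p\perp r$ and $\{q,r,s\}$ collinear imply $p\perp s$. For $U\subseteq P$ let $U^\perp=\{q\in P\mid q\perp p\text{ for all }p\in U\}$. **MOL-spaces.** A subspace topology on $P$ is a $0$-$1$-sublattice $\mathcal O$ of $\mathcal S(P)$ closed under arbitrary joins; its members are the open subspaces. Directed systems are understood to be non-empty. A set $A\subseteq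 P$ is s-compact if whenever $A\subseteq\bigcup_{i\in I}U_i$ with a directed system of open subspaces $U_i$, then $A\subseteq U_i$ for some $i$. An s-basis of $\mathcal O$ is a $0$-sublattice $\mathcal B\subseteq\mathcal O$ such that every member of $\mathcal O$ is a directed union of members of $\mathcal B$. An MOL-space is a projective space $P$ with an anisotropic orthogonality $\perp$ and a subspace topology $\mathcal O$ such that $P$ is s-compact and $\mathcal O$ has an s-basis $\mathcal B$ with * $U^\perp\in\mathcal O$ and $U+U^\perp=P$ for all $U\in\mathcal B$; * if $p\perp q$ then $p\in U$ and $q\in U^\perp$ for some $U\in\mathcal B$. An MOL-space is Frinkian if * (strongly Hausdorff) for any finitely many points $q_1,\dots,q_n$ and any point $p\notin q_1+\dots+q_n$ there are $U,V\in\mathcal O$ with $p\in U$, $q_1,\dots,q_n\in V$ and $U\cap V=\emptyset$; and * if $P=\bigl(\bigcup_{i\in I}U_i\bigr)^{\perp\perp}$ for a directed system of open subspaces $U_i$, then $P=U_i$ for some $i\in I$. **Frink spaces.** The Frink space of an MOL $L$ has as points the maximal proper filters of $L$. Three distinct points $p,q,r$ are collinear iff $p\cap q=p\cap r=q\cap r$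 (that is, their pairwise joins in the filter lattice, ordered by reverse inclusion, coincide). The canonical orthogonality is: $p\perp q$ iff $a\le b'$ for some $a\in p$, $b\in q$. The open subspaces are the joins of the basic ones $U(a)=\{p\mid a\in p\}$, $a\in L$. **Theorem 3.14.** 1. For every MOL $L$, the Frink space of $L$ is a Frinkian MOL-space with s-basis $\{U(a)\mid a\in L\}$, and $a\mapsto U(a)$ is an isomorphism of $L$ onto the algebra of s-compact open subspaces of this space, with the operations $\cap$, $+$, $^\perp$, $\emptyset$, $P$. 2. For every Frinkian MOL-space $P$, the s-compact open subspaces form an MOL $L(P)$ with the operations $\cap$, $+$, $^\perp$, $\emptyset$, $P$, and $p\mapsto\{U\in L(P)\mid p\in U\}$ is an isomorphism of $P$ onto the Frink space of $L(P)$, that is, a bijection which preserves and reflects collinearity, orthogonality and openness of sets. 3. Two MOLs are isomorphic if and only if their Frink spaces are isomorphic (in the sense of 2.). Hence MOLs and Frinkian MOL-spaces correspond to each other bijectively up to isomorphism. -/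

import Mathlib

universe u

/-- A modular ortholattice (MOL): a bounded modular lattice with an orthocomplementation. -/
class MOL (L : Type u) extends Lattice L, BoundedOrder L, IsModularLattice L, Compl L where
  sup_compl : ∀ x : L, x ⊔ xᶜ = ⊤
  inf_compl : ∀ x : L, x ⊓ xᶜ = ⊥
  compl_compl : ∀ x : L, xᶜᶜ = x
  compl_anti : ∀ x y : L, x ≤ y → yᶜ ≤ xᶜ

/-- An isomorphism of MOLs exists. (An order isomorphism preserves joins, meets and bounds.) -/
def MOLIsomorphic (L K : Type u) [MOL L] [MOL K] : Prop :=
  ∃ e : L ≃o K, ∀ a : L, e aᶜ = (e a)ᶜ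

/-- A set of points containing with two points all points collinear with them. -/
def IsCollClosed {P : Type u} (Coll : P → P → P → Prop) (U : Set P) : Prop :=
  ∀ p ∈ U, ∀ q ∈ U, ∀ r, Coll p q r → r ∈ U

/-- The smallest set containing `S` and closed under collinearity. -/
def collSpan {P : Type u} (Coll : P → P → P → Prop) (S : Set P) : Set P :=
  ⋂₀ {V | IsCollClosed Coll V ∧ S ⊆ V}

/-- The raw data of a point set with collinear triplets, an orthogonality relation and a
family of open subspaces. All axioms are imposed by the predicates below. -/
structure OrthoSpace (P : Type u) where
  Coll : P → P → P → Prop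
  Orth : P → P → Prop
  opens : Set (Set P)

namespace OrthoSpace

variable {P : Type u} (X : OrthoSpace P)

/-- The axioms of a projective space. The first three fields say that `Coll` is a set of
3-element subsets; the last one is the triangle axiom. -/
structure IsProjective : Prop where
  swap : ∀ p q r, X.Coll p q r → X.Coll q p r
  rotate : ∀ p q r, X.Coll p q r → X.Coll q r p
  ne : ∀ p q r, X.Coll p q r → p ≠ q
  triangle : ∀ p q r s t, X.Coll p s q → X.Coll q t r → p ≠ r → ¬ X.Coll p q r →
    ∃! u, X.Coll p r u ∧ X.Coll s t u

/-- Subspaces of the projective space. -/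
def IsSubspace (U : Set P) : Prop := IsCollClosed X.Coll U

/-- The subspace generated by a set of points; joins of subspaces are spans of unions. -/
def span (S : Set P) : Set P := collSpan X.Coll S

/-- The join of two subspaces. -/
def join (U V : Set P) : Set P := X.span (U ∪ V)

/-- An anisotropic orthogonality on the points of a projective space. -/
structure IsAnisotropicOrthogonality : Prop where
  symm : ∀ p q, X.Orth p q → X.Orth q p
  coll : ∀ p q r s, X.Orth p q → X.Orth p r → X.Coll q r s → X.Orth p s
  aniso : ∀ p, ¬ X.Orth p p

/-- The points orthogonal to all points of `U`. -/
def perp (U : Set P) : Set P := {q | ∀ p ∈ U, X.Orth q p}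

/-- The open sets form a 0-1-sublattice of the lattice of subspaces that is closed under
arbitrary joins. -/
structure IsSubspaceTopology : Prop where
  isSubspace : ∀ U ∈ X.opens, X.IsSubspace U
  empty_mem : ∅ ∈ X.opens
  univ_mem : Set.univ ∈ X.opens
  inter_mem : ∀ U ∈ X.opens, ∀ V ∈ X.opens, U ∩ V ∈ X.opens
  join_mem : ∀ U ∈ X.opens, ∀ V ∈ X.opens, X.join U V ∈ X.opens
  sSup_mem : ∀ S ⊆ X.opens, X.span (⋃₀ S) ∈ X.opens

/-- A (nonempty) directed system of open subspaces. -/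
structure IsDirectedSystem (D : Set (Set P)) : Prop where
  subset_opens : D ⊆ X.opens
  nonempty : D.Nonempty
  directed : DirectedOn (· ⊆ ·) D

/-- s-compactness: each covering by a directed system of open subspaces has a covering member. -/
def IsSCompact (A : Set P) : Prop :=
  ∀ D, X.IsDirectedSystem D → A ⊆ ⋃₀ D → ∃ U ∈ D, A ⊆ U

/-- An s-basis: a 0-sublattice of open subspaces such that each open subspace is a directed
union of members. -/
structure IsSBasis (B : Set (Set P)) : Prop where
  subset_opens : B ⊆ X.opens
  empty_mem : ∅ ∈ B
  inter_mem : ∀ U ∈ B, ∀ V ∈ B, U ∩ V ∈ B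
  join_mem : ∀ U ∈ B, ∀ V ∈ B, X.join U V ∈ B
  exists_directed : ∀ U ∈ X.opens, ∃ D ⊆ B, X.IsDirectedSystem D ∧ U = ⋃₀ D

/-- MOL-spaces. The last conjunct says that the orthogonality is determined by the basis: two
points are orthogonal only if some basic `U` contains one and `Uᗮ` the other (the converse
is automatic). -/
structure IsMOLSpace : Prop where
  projective : X.IsProjective
  orthogonality : X.IsAnisotropicOrthogonality
  topology : X.IsSubspaceTopology
  sCompact : X.IsSCompact Set.univ
  exists_basis : ∃ B, X.IsSBasis B ∧
    (∀ U ∈ B, X.perp U ∈ X.opens ∧ X.join U (X.perp U) = Set.univ) ∧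
    (∀ p q, X.Orth p q → ∃ U ∈ B, p ∈ U ∧ q ∈ X.perp U)

/-- A point and a finite set of points whose span does not contain it can be separated by
disjoint open subspaces. -/
def IsStronglyHausdorff : Prop :=
  ∀ (p : P) (F : Finset P), p ∉ X.span (F : Set P) →
    ∃ U ∈ X.opens, ∃ V ∈ X.opens, p ∈ U ∧ (F : Set P) ⊆ V ∧ U ∩ V = ∅

/-- Frinkian MOL-spaces. -/
structure IsFrinkian : Prop where
  molSpace : X.IsMOLSpace
  stronglyHausdorff : X.IsStronglyHausdorff
  univ_mem_of_dense : ∀ D, X.IsDirectedSystem D →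
    X.perp (X.perp (⋃₀ D)) = Set.univ → Set.univ ∈ D

/-- The s-compact open subspaces. -/
structure SCompactOpen where
  carrier : Set P
  isOpen : carrier ∈ X.opens
  isSCompact : X.IsSCompact carrier

/-- `φ` is an isomorphism of the MOL `L` onto the algebra of s-compact open subspaces, with the
operations of the subspace lattice and `U ↦ Uᗮ`. -/
structure IsIsoOntoSCompactOpens {L : Type u} [MOL L] (φ : L → Set P) : Prop where
  injective : Function.Injective φ
  range_eq : Set.range φ = {U | U ∈ X.opens ∧ X.IsSCompact U}
  map_bot : φ ⊥ = ∅
  map_top : φ ⊤ = Set.univ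
  map_inf : ∀ a b, φ (a ⊓ b) = φ a ∩ φ b
  map_sup : ∀ a b, φ (a ⊔ b) = X.join (φ a) (φ b)
  map_compl : ∀ a, φ aᶜ = X.perp (φ a)

/-- Isomorphisms of spaces: collineations that preserve and reflect orthogonality and
openness. -/
structure IsIso {Q : Type u} (Y : OrthoSpace Q) (f : P → Q) : Prop where
  bijective : Function.Bijective f
  coll_iff : ∀ p q r, X.Coll p q r ↔ Y.Coll (f p) (f q) (f r)
  orth_iff : ∀ p q, X.Orth p q ↔ Y.Orth (f p) (f q)
  open_iff : ∀ U : Set P, U ∈ X.opens ↔ f '' U ∈ Y.opens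

end OrthoSpace

/-- The points of the Frink space: the maximal proper filters of `L`. -/
def FrinkPoint (L : Type u) [MOL L] : Type u := {F : Order.PFilter L // IsCoatom F}

namespace FrinkPoint

variable {L : Type u} [MOL L]

/-- The set of elements of the filter `p`. -/
def toSet (p : FrinkPoint L) : Set L := (p.1 : Set L)

/-- The set `U(a)` of all points below `a`, that is, of all maximal filters containing `a`. -/
def basic (a : L) : Set (FrinkPoint L) := {p | a ∈ p.toSet}

/-- Collinearity in the Frink space. In the filter lattice, ordered by reverse inclusion, the join
of two filters is their intersection, so three distinct points are collinear iff their pairwise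
intersections agree. -/
def Coll (p q r : FrinkPoint L) : Prop :=
  p ≠ q ∧ p ≠ r ∧ q ≠ r ∧
    p.toSet ∩ q.toSet = p.toSet ∩ r.toSet ∧ p.toSet ∩ r.toSet = q.toSet ∩ r.toSet

/-- The canonical orthogonality: `F ⟂ G` iff `a ⟂ b`, i.e. `a ≤ bᶜ`, for some `a ∈ F`, `b ∈ G`. -/
def Orth (p q : FrinkPoint L) : Prop :=
  ∃ a ∈ p.toSet, ∃ b ∈ q.toSet, a ≤ bᶜ

end FrinkPoint

/-- The Frink space of an MOL; the open subspaces are the joins of basic ones `U(a)`. -/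
def frinkSpace (L : Type u) [MOL L] : OrthoSpace (FrinkPoint L) where
  Coll := FrinkPoint.Coll
  Orth := FrinkPoint.Orth
  opens := {V | ∃ A : Set L, V = collSpan FrinkPoint.Coll (⋃ a ∈ A, FrinkPoint.basic a)}

/-! Ordered by reverse inclusion, the filters of an MOL form a modular lattice whose atoms are the
maximal proper filters. Modularity alone turns the atoms into a projective space
(`IsAtom.triangle`). Projecting atoms (`IsAtom.project`) gives `basic_sup` and `basic_compl`, so `a
↦ U(a)` respects all operations. If no member of a directed system contains `U(a)`, then the
elements `a ⊓ bᶜ`, where `b ≤ a` and `U(b)` lies in some member, generate a proper filter; a maximal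
filter above it is a point of `U(a)` orthogonal to all these `U(b)`. This one point yields both
s-compactness and the density condition.

Conversely, in an MOL-space the modular law for subspaces makes complemented opens s-compact. Hence
the required basis can only be the set of all s-compact opens, and these form an MOL. In a Frinkian
space, strong Hausdorffness separates points, and the density condition says that a downward
directed family of s-compact opens with empty intersection contains the empty set. Together they
identify the points with the maximal filters of that MOL.

The return map is built for an arbitrary representation `φ` of an MOL by the s-compact opens. The
comparison of MOLs with their Frink spaces then only requires composing `φ` with an isomorphism. -/

/-! ### Atoms in modular lattices. -/

section ModularAtoms

variable {M : Type*} [Lattice M] [OrderBot M]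

/-- By modularity `x ⊔ y` covers `x`, so nothing lies strictly between them and `x ⊔ z` must be all
of `x ⊔ y`. -/
theorem IsAtom.le_sup_exchange [IsModularLattice M] {x y z : M} (hx : IsAtom x) (hy : IsAtom y)
    (hz : IsAtom z) (hne : z ≠ x) (h : z ≤ x ⊔ y) : y ≤ x ⊔ z := by
  have hyx : ¬ y ≤ x := fun hyx =>
    hne ((hx.le_iff_eq hz.1).1 (h.trans (sup_le le_rfl hyx)))
  have hcov : x ⋖ x ⊔ y := by
    apply covBy_sup_of_inf_covBy_right
    rw [inf_comm, (hy.not_le_iff_disjoint.1 hyx).eq_bot]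
    exact bot_covBy_iff.2 hy
  have hzx : ¬ z ≤ x := fun hzx => hne ((hx.le_iff_eq hz.1).1 hzx)
  have h1 : x < x ⊔ z := left_lt_sup.2 hzx
  have h2 : x ⊔ z ≤ x ⊔ y := sup_le le_sup_left h
  rw [(hcov.eq_or_eq le_sup_left h2).resolve_left h1.ne']
  exact le_sup_right

/-- Projecting the atom `p` from `b` onto a disjoint element `a`. -/
theorem IsAtom.project [IsModularLattice M] {p a b : M} (hp : IsAtom p) (hpb : ¬ p ≤ b)
    (hab : Disjoint a b) (h : p ≤ a ⊔ b) :
    IsAtom (a ⊓ (p ⊔ b)) ∧ a ⊓ (p ⊔ b) ⊔ b = p ⊔ b := by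
  have hs : a ⊓ (p ⊔ b) ⊔ b = p ⊔ b := by
    rw [sup_comm, ← sup_inf_assoc_of_le a (le_sup_right : b ≤ p ⊔ b)]
    exact inf_eq_right.2 (sup_le (h.trans (sup_comm _ _).le) le_sup_left)
  refine ⟨?_, hs⟩
  -- The covering of `b` by `p ⊔ b` transposes down to a covering of `⊥` by the projection.
  have hcov : b ⋖ p ⊔ b := by
    apply covBy_sup_of_inf_covBy_left
    rw [(hp.not_le_iff_disjoint.1 hpb).eq_bot]
    exact bot_covBy_iff.2 hp
  rw [← hs] at hcov
  have h2 := inf_covBy_of_covBy_sup_right hcov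
  rw [(hab.mono_left inf_le_left).eq_bot] at h2
  exact bot_covBy_iff.1 h2

/-- The intersection point is the projection of `s` from `t` onto `p ⊔ r`. The remaining claims
follow by exchange; they guarantee that this point differs from `p`, `r`, `s` and `t`. -/
theorem IsAtom.triangle [IsModularLattice M] {p q r s t : M} (hp : IsAtom p) (hq : IsAtom q)
    (hr : IsAtom r) (hs : IsAtom s) (ht : IsAtom t) (hpq : p ≠ q)
    (hsp : s ≠ p) (hsq : s ≠ q) (htq : t ≠ q) (htr : t ≠ r) (hspq : s ≤ p ⊔ q)
    (htqr : t ≤ q ⊔ r) (hr' : ¬ r ≤ p ⊔ q) :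
    s ≠ t ∧ IsAtom ((p ⊔ r) ⊓ (s ⊔ t)) ∧ ¬ p ≤ s ⊔ t ∧ ¬ r ≤ s ⊔ t ∧ ¬ s ≤ p ⊔ r ∧
      ¬ t ≤ p ⊔ r := by
  have htpq : ¬ t ≤ p ⊔ q := fun h =>
    hr' ((hq.le_sup_exchange hr ht htq htqr).trans (sup_le le_sup_right h))
  have hpqr : ¬ p ≤ q ⊔ r := fun h =>
    hr' ((hq.le_sup_exchange hr hp hpq h).trans (sup_comm _ _).le)
  have htpr : ¬ t ≤ p ⊔ r := fun h =>
    hpqr ((hr.le_sup_exchange hp ht htr (h.trans (sup_comm _ _).le)).trans (sup_le le_sup_right htqr))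
  have hspr : ¬ s ≤ p ⊔ r := fun h =>
    hr' ((hp.le_sup_exchange hr hs hsp h).trans (sup_le le_sup_left hspq))
  have hsqr : ¬ s ≤ q ⊔ r := fun h =>
    hpqr ((hq.le_sup_exchange hp hs hsq (hspq.trans (sup_comm _ _).le)).trans (sup_le le_sup_left h))
  have hst : s ≠ t := fun h => hsqr (h ▸ htqr)
  have hqt : q ≤ r ⊔ t := hr.le_sup_exchange hq ht htr (htqr.trans (sup_comm _ _).le)
  refine ⟨hst, ?_, ?_, ?_, hspr, htpr⟩
  · refine (hs.project (a := p ⊔ r) (b := t) (fun h => hst ((ht.le_iff_eq hs.1).1 h))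
      (ht.not_le_iff_disjoint.1 htpr).symm (hspq.trans ?_)).1
    exact sup_le (le_sup_left.trans le_sup_left)
      (hqt.trans (sup_le (le_sup_right.trans le_sup_left) le_sup_right))
  · intro h
    exact htpq ((hs.le_sup_exchange ht hp hsp.symm h).trans (sup_le hspq le_sup_left))
  · intro h
    exact hsqr ((ht.le_sup_exchange hs hr htr.symm (h.trans (sup_comm _ _).le)).trans
      (sup_le htqr le_sup_right))

end ModularAtoms

/-! ### The modular lattice of filters. -/

namespace Order.PFilter

variable {L : Type*} [Lattice L] [OrderTop L]

/-- A filter of a lattice from a set with the usual closure properties. -/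
def ofSet (S : Set L) (top : ⊤ ∈ S) (inf : ∀ a ∈ S, ∀ b ∈ S, a ⊓ b ∈ S)
    (up : ∀ a ∈ S, ∀ b, a ≤ b → b ∈ S) : PFilter L :=
  IsPFilter.toPFilter (F := S) (IsPFilter.of_def ⟨⊤, top⟩
    (fun a ha b hb => ⟨a ⊓ b, inf a ha b hb, inf_le_left, inf_le_right⟩)
    (fun {x y} hxy hx => up x hx y hxy))

instance : Lattice (PFilter L) where
  sup F G := ofSet {x | ∃ a ∈ F, ∃ b ∈ G, a ⊓ b ≤ x} ⟨⊤, top_mem, ⊤, top_mem, le_top⟩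
    (by
      rintro x ⟨a, ha, b, hb, h⟩ y ⟨c, hc, d, hd, h'⟩
      refine ⟨a ⊓ c, inf_mem ha hc, b ⊓ d, inf_mem hb hd, ?_⟩
      rw [inf_inf_inf_comm]
      exact inf_le_inf h h')
    (by
      rintro x ⟨a, ha, b, hb, h⟩ y hxy
      exact ⟨a, ha, b, hb, h.trans hxy⟩)
  le_sup_left F G x hx := ⟨x, hx, ⊤, top_mem, inf_le_left⟩
  le_sup_right F G x hx := ⟨⊤, top_mem, x, hx, inf_le_right⟩
  sup_le F G H hF hG := by
    rintro x ⟨a, ha, b, hb, h⟩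
    exact mem_of_le h (inf_mem (hF ha) (hG hb))
  inf F G := ofSet {x | x ∈ F ∧ x ∈ G} ⟨top_mem, top_mem⟩
    (fun a ha b hb => ⟨inf_mem ha.1 hb.1, inf_mem ha.2 hb.2⟩)
    (fun a ha b hab => ⟨mem_of_le hab ha.1, mem_of_le hab ha.2⟩)
  inf_le_left F G x hx := hx.1
  inf_le_right F G x hx := hx.2
  le_inf F G H hG hH x hx := ⟨hG hx, hH hx⟩

theorem mem_sup {F G : PFilter L} {x : L} : x ∈ F ⊔ G ↔ ∃ a ∈ F, ∃ b ∈ G, a ⊓ b ≤ x := Iff.rfl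

instance [IsModularLattice L] : IsModularLattice (PFilter L) where
  sup_inf_le_assoc_of_le {F} G {H} hFH := by
    rintro x ⟨⟨f, hf, g, hg, h⟩, hx⟩
    -- The element `x ⊓ f ⊔ g` lies in `G` because of `g` and in `H` because of `x ⊓ f`; by
    -- modularity its meet with `f` is `x ⊓ f ⊔ g ⊓ f ≤ x`.
    refine ⟨f, hf, x ⊓ f ⊔ g, ⟨mem_of_le le_sup_right hg,
      mem_of_le le_sup_left (inf_mem hx (hFH hf))⟩, ?_⟩
    rw [inf_comm, sup_inf_assoc_of_le g (inf_le_right : x ⊓ f ≤ f)]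
    exact sup_le inf_le_left ((inf_comm _ _).le.trans h)

theorem mem_top {L : Type*} [Lattice L] [OrderBot L] (x : L) : x ∈ (⊤ : PFilter L) := trivial

theorem eq_top_of_bot_mem {L : Type*} [Lattice L] [OrderBot L] {F : PFilter L} (h : ⊥ ∈ F) :
    F = ⊤ :=
  top_le_iff.1 fun _ _ => mem_of_le bot_le h

theorem exists_isCoatom_ge {L : Type*} [Lattice L] [OrderBot L] (F : PFilter L) (hF : ⊥ ∉ F) :
    ∃ G : PFilter L, IsCoatom G ∧ F ≤ G := by
  rcases eq_top_or_exists_le_coatom F.dual with h | ⟨I, hI, hle⟩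
  · exact (hF (show OrderDual.toDual (⊥ : L) ∈ F.dual from h ▸ trivial)).elim
  · refine ⟨⟨I⟩, ⟨fun h => hI.1 (congrArg PFilter.dual h), fun G hG => ?_⟩, hle⟩
    have : I < G.dual := hG
    exact congrArg PFilter.mk (hI.2 _ this)

end Order.PFilter

/-! ### Closure under collinearity. -/

section Span

variable {P Q : Type u} {Coll : P → P → P → Prop}

theorem isCollClosed_collSpan (S : Set P) : IsCollClosed Coll (collSpan Coll S) :=
  fun p hp q hq r h V hV => hV.1 p (hp V hV) q (hq V hV) r h

theorem subset_collSpan (S : Set P) : S ⊆ collSpan Coll S := fun _ hp _ hV => hV.2 hp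

theorem collSpan_subset {S V : Set P} (hV : IsCollClosed Coll V) (h : S ⊆ V) :
    collSpan Coll S ⊆ V := fun _ hp => hp V ⟨hV, h⟩

theorem collSpan_mono {S T : Set P} (h : S ⊆ T) : collSpan Coll S ⊆ collSpan Coll T :=
  collSpan_subset (isCollClosed_collSpan T) (h.trans (subset_collSpan T))

theorem collSpan_eq {S : Set P} (hS : IsCollClosed Coll S) : collSpan Coll S = S :=
  (collSpan_subset hS subset_rfl).antisymm (subset_collSpan S)

theorem IsCollClosed.inter {U V : Set P} (hU : IsCollClosed Coll U) (hV : IsCollClosed Coll V) :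
    IsCollClosed Coll (U ∩ V) :=
  fun p hp q hq r h => ⟨hU p hp.1 q hq.1 r h, hV p hp.2 q hq.2 r h⟩

theorem isCollClosed_sUnion_of_directedOn {D : Set (Set P)} (hD : DirectedOn (· ⊆ ·) D)
    (h : ∀ U ∈ D, IsCollClosed Coll U) : IsCollClosed Coll (⋃₀ D) := by
  rintro p ⟨U, hU, hpU⟩ q ⟨V, hV, hqV⟩ r hr
  obtain ⟨W, hW, hUW, hVW⟩ := hD U hU V hV
  exact ⟨W, hW, h W hW p (hUW hpU) q (hVW hqV) r hr⟩

theorem image_collSpan {Coll' : Q → Q → Q → Prop} {f : P → Q} (hf : Function.Bijective f)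
    (h : ∀ p q r, Coll p q r ↔ Coll' (f p) (f q) (f r)) (S : Set P) :
    f '' collSpan Coll S = collSpan Coll' (f '' S) := by
  apply Set.Subset.antisymm
  · rw [Set.image_subset_iff]
    refine collSpan_subset (fun p hp q hq r hr => ?_) fun p hp =>
      subset_collSpan _ (Set.mem_image_of_mem f hp)
    exact isCollClosed_collSpan _ _ hp _ hq _ ((h p q r).1 hr)
  · refine collSpan_subset ?_ (Set.image_mono (subset_collSpan S))
    rintro _ ⟨p, hp, rfl⟩ _ ⟨q, hq, rfl⟩ r hr
    obtain ⟨r, rfl⟩ := hf.2 r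
    exact ⟨r, isCollClosed_collSpan _ _ hp _ hq _ ((h p q r).2 hr), rfl⟩

end Span

/-! ### Complements and the orthomodular law. -/

namespace MOL

variable {L : Type u} [MOL L]

theorem le_compl_comm {a b : L} (h : a ≤ bᶜ) : b ≤ aᶜ := by
  simpa [MOL.compl_compl] using MOL.compl_anti _ _ h

theorem compl_top : (⊤ : L)ᶜ = ⊥ := by simpa using MOL.inf_compl (⊤ : L)

theorem compl_sup (a b : L) : (a ⊔ b)ᶜ = aᶜ ⊓ bᶜ := by
  apply le_antisymm
  · exact le_inf (MOL.compl_anti _ _ le_sup_left) (MOL.compl_anti _ _ le_sup_right)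
  · exact le_compl_comm (sup_le (le_compl_comm inf_le_left) (le_compl_comm inf_le_right))

theorem sup_inf_compl_of_le {a b : L} (h : b ≤ a) : b ⊔ a ⊓ bᶜ = a := by
  rw [inf_comm, ← sup_inf_assoc_of_le _ h, MOL.sup_compl, top_inf_eq]

theorem eq_of_le_of_inf_compl_eq_bot {a b : L} (h : b ≤ a) (h0 : a ⊓ bᶜ = ⊥) : b = a := by
  rw [← sup_inf_compl_of_le h, h0, sup_bot_eq]

end MOL

open Order OrderDual

/-! ### Maximal filters as points: collinearity and orthogonality. -/

namespace FrinkPoint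

variable {L : Type u} [MOL L]

theorem ext {p q : FrinkPoint L} (h : p.toSet = q.toSet) : p = q :=
  Subtype.ext (PFilter.ext _ _ h)

theorem top_mem (p : FrinkPoint L) : ⊤ ∈ p.toSet := PFilter.top_mem (F := p.1)

theorem bot_notMem (p : FrinkPoint L) : ⊥ ∉ p.toSet :=
  fun h => p.2.1 (PFilter.eq_top_of_bot_mem h)

theorem inf_mem {p : FrinkPoint L} {a b : L} (ha : a ∈ p.toSet) (hb : b ∈ p.toSet) :
    a ⊓ b ∈ p.toSet := PFilter.inf_mem (F := p.1) ha hb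

theorem mem_of_le {p : FrinkPoint L} {a b : L} (h : a ≤ b) (ha : a ∈ p.toSet) : b ∈ p.toSet :=
  PFilter.mem_of_le (F := p.1) h ha

/-- A point as an atom of the lattice of filters, ordered by reverse inclusion. -/
def atom (p : FrinkPoint L) : (PFilter L)ᵒᵈ := toDual p.1

theorem isAtom_atom (p : FrinkPoint L) : IsAtom p.atom := p.2.dual

theorem atom_injective : Function.Injective (atom (L := L)) := fun _ _ h => Subtype.ext h

theorem exists_atom_eq {x : (PFilter L)ᵒᵈ} (hx : IsAtom x) : ∃ p : FrinkPoint L, p.atom = x :=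
  ⟨⟨ofDual x, hx.dual⟩, rfl⟩

theorem atom_le_iff_eq {p q : FrinkPoint L} : p.atom ≤ q.atom ↔ p = q := by
  rw [q.isAtom_atom.le_iff_eq p.isAtom_atom.1, atom_injective.eq_iff]

theorem atom_le_principal {p : FrinkPoint L} {a : L} :
    p.atom ≤ toDual (PFilter.principal a) ↔ a ∈ p.toSet :=
  PFilter.principal_le_iff

theorem disjoint_principal {a b : L} (h : a ⊓ b = ⊥) :
    Disjoint (toDual (PFilter.principal a)) (toDual (PFilter.principal b)) := by
  rw [disjoint_iff_inf_le]
  intro x _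
  exact ⟨a, le_rfl, b, le_rfl, h.le.trans bot_le⟩

theorem principal_sup (a b : L) : toDual (PFilter.principal (a ⊔ b)) =
    toDual (PFilter.principal a) ⊔ toDual (PFilter.principal b) := by
  apply le_antisymm
  · rintro x ⟨h1, h2⟩
    exact sup_le (PFilter.mem_principal.1 h1) (PFilter.mem_principal.1 h2)
  · exact fun x hx => ⟨le_sup_left.trans hx, le_sup_right.trans hx⟩

theorem mem_of_atom_le_sup {p q r : FrinkPoint L} (h : r.atom ≤ p.atom ⊔ q.atom) {a : L}
    (hp : a ∈ p.toSet) (hq : a ∈ q.toSet) : a ∈ r.toSet := h ⟨hp, hq⟩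

/-- One inequality suffices: by exchange each of the three atoms lies below the join of the other
two, which makes all pairwise intersections equal. -/
theorem coll_iff {p q r : FrinkPoint L} :
    Coll p q r ↔ p ≠ q ∧ p ≠ r ∧ q ≠ r ∧ r.atom ≤ p.atom ⊔ q.atom := by
  refine ⟨fun ⟨h1, h2, h3, h4, h5⟩ => ⟨h1, h2, h3, fun a ha => ?_⟩,
    fun ⟨h1, h2, h3, h⟩ => ⟨h1, h2, h3, ?_⟩⟩
  · exact (h4.subset (show a ∈ p.toSet ∩ q.toSet from ha)).2
  · have hq := p.isAtom_atom.le_sup_exchange q.isAtom_atom r.isAtom_atom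
      (atom_injective.ne h2.symm) h
    have hp := q.isAtom_atom.le_sup_exchange p.isAtom_atom r.isAtom_atom
      (atom_injective.ne h3.symm) (h.trans (sup_comm _ _).le)
    constructor
    · ext a
      exact ⟨fun ha => ⟨ha.1, mem_of_atom_le_sup h ha.1 ha.2⟩,
        fun ha => ⟨ha.1, mem_of_atom_le_sup hq ha.1 ha.2⟩⟩
    · ext a
      exact ⟨fun ha => ⟨mem_of_atom_le_sup hq ha.1 ha.2, ha.2⟩,
        fun ha => ⟨mem_of_atom_le_sup hp ha.1 ha.2, ha.2⟩⟩

theorem Coll.swap {p q r : FrinkPoint L} (h : Coll p q r) : Coll q p r :=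
  ⟨h.1.symm, h.2.2.1, h.2.1, by rw [Set.inter_comm, h.2.2.2.1, h.2.2.2.2], h.2.2.2.2.symm⟩

theorem Coll.rotate {p q r : FrinkPoint L} (h : Coll p q r) : Coll q r p :=
  ⟨h.2.2.1, h.1.symm, h.2.1.symm, by
    rw [← h.2.2.2.2, ← h.2.2.2.1, Set.inter_comm], by
    rw [Set.inter_comm, h.2.2.2.1, Set.inter_comm]⟩

theorem isProjective : (frinkSpace L).IsProjective where
  swap _ _ _ h := Coll.swap h
  rotate _ _ _ h := Coll.rotate h
  ne _ _ _ h := h.1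
  triangle p q r s t hpsq hqtr hpr hn := by
    have hpqs := coll_iff.1 (Coll.rotate (Coll.swap hpsq))
    have hqrt := coll_iff.1 (Coll.rotate (Coll.swap hqtr))
    obtain ⟨hpq, hps, hqs, hs⟩ := hpqs
    obtain ⟨hqr, hqt, hrt, ht⟩ := hqrt
    have hr : ¬ r.atom ≤ p.atom ⊔ q.atom := fun h => hn (coll_iff.2 ⟨hpq, hpr, hqr, h⟩)
    obtain ⟨hst, hu, h1, h2, h3, h4⟩ := IsAtom.triangle p.isAtom_atom q.isAtom_atom r.isAtom_atom
      s.isAtom_atom t.isAtom_atom (atom_injective.ne hpq) (atom_injective.ne hps.symm)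
      (atom_injective.ne hqs.symm) (atom_injective.ne hqt.symm) (atom_injective.ne hrt.symm)
      hs ht hr
    obtain ⟨u, hu'⟩ := exists_atom_eq hu
    have hupr : u.atom ≤ p.atom ⊔ r.atom := hu'.le.trans inf_le_left
    have hust : u.atom ≤ s.atom ⊔ t.atom := hu'.le.trans inf_le_right
    refine ⟨u, ⟨coll_iff.2 ⟨hpr, ?_, ?_, hupr⟩,
      coll_iff.2 ⟨fun h => hst (congrArg atom h), ?_, ?_, hust⟩⟩, ?_⟩
    · rintro rfl; exact h1 hust
    · rintro rfl; exact h2 hust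
    · rintro rfl; exact h3 hupr
    · rintro rfl; exact h4 hupr
    · rintro v ⟨hv1, hv2⟩
      rw [← atom_le_iff_eq, hu']
      exact le_inf (coll_iff.1 hv1).2.2.2 (coll_iff.1 hv2).2.2.2

theorem isAnisotropicOrthogonality : (frinkSpace L).IsAnisotropicOrthogonality where
  symm := fun _ _ ⟨a, ha, b, hb, h⟩ => ⟨b, hb, a, ha, MOL.le_compl_comm h⟩
  coll := by
    rintro p q r s ⟨a, ha, b, hb, h⟩ ⟨c, hc, d, hd, h'⟩ hs
    -- The join `b ⊔ d` belongs to both `q` and `r`, hence to every point on their line.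
    refine ⟨a ⊓ c, inf_mem ha hc, b ⊔ d, ?_, ?_⟩
    · exact mem_of_atom_le_sup (coll_iff.1 hs).2.2.2 (mem_of_le le_sup_left hb)
        (mem_of_le le_sup_right hd)
    · rw [MOL.compl_sup]
      exact inf_le_inf h h'
  aniso := by
    rintro p ⟨a, ha, b, hb, h⟩
    refine p.bot_notMem ?_
    rw [← MOL.inf_compl b]
    exact inf_mem hb (mem_of_le h ha)

/-! ### The basic subspaces and the operations of the MOL. -/

theorem isCollClosed_basic (a : L) : IsCollClosed Coll (basic a) :=
  fun _ hp _ hq _ h => mem_of_atom_le_sup (coll_iff.1 h).2.2.2 hp hq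

theorem basic_mono {a b : L} (h : a ≤ b) : basic a ⊆ basic b := fun _ hp => mem_of_le h hp

theorem basic_bot : basic (⊥ : L) = ∅ := Set.eq_empty_of_forall_notMem fun p => p.bot_notMem

theorem basic_top : basic (⊤ : L) = Set.univ := Set.eq_univ_of_forall fun p => p.top_mem

theorem basic_inf (a b : L) : basic (a ⊓ b) = basic a ∩ basic b := by
  ext p
  exact ⟨fun h => ⟨mem_of_le inf_le_left h, mem_of_le inf_le_right h⟩, fun h => inf_mem h.1 h.2⟩

/-- A downward directed set of nonzero elements is contained in a maximal proper filter. -/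
theorem exists_superset {S : Set L} (hne : S.Nonempty) (hdir : DirectedOn (· ≥ ·) S)
    (hS : ⊥ ∉ S) : ∃ p : FrinkPoint L, S ⊆ p.toSet := by
  obtain ⟨s, hs⟩ := hne
  let F : PFilter L := PFilter.ofSet {x | ∃ a ∈ S, a ≤ x} ⟨s, hs, le_top⟩
    (by
      rintro a ⟨c, hc, hca⟩ b ⟨d, hd, hdb⟩
      obtain ⟨e, he, hce, hde⟩ := hdir c hc d hd
      exact ⟨e, he, le_inf (le_trans hce hca) (le_trans hde hdb)⟩)
    (by
      rintro a ⟨c, hc, hca⟩ b hab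
      exact ⟨c, hc, hca.trans hab⟩)
  obtain ⟨G, hG, hFG⟩ := F.exists_isCoatom_ge (by
    rintro ⟨a, ha, h⟩
    exact hS (le_bot_iff.1 h ▸ ha))
  exact ⟨⟨G, hG⟩, fun a ha => hFG ⟨a, ha, le_rfl⟩⟩

theorem exists_mem {a : L} (ha : a ≠ ⊥) : ∃ p : FrinkPoint L, a ∈ p.toSet := by
  obtain ⟨p, hp⟩ := exists_superset (S := {a}) ⟨a, rfl⟩
    (by rintro _ rfl _ rfl; exact ⟨_, rfl, le_rfl, le_rfl⟩) (fun h => ha h.symm)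
  exact ⟨p, hp rfl⟩

/-- Maximal filters need not be prime, so the separating point is taken through the relative
complement of `a ⊓ b` in `a`, which is nonzero unless `a ≤ b`. -/
theorem basic_subset_iff {a b : L} : basic a ⊆ basic b ↔ a ≤ b := by
  refine ⟨fun h => ?_, basic_mono⟩
  by_contra hab
  have h0 : a ⊓ (a ⊓ b)ᶜ ≠ ⊥ := fun h0 =>
    hab (inf_eq_left.1 (MOL.eq_of_le_of_inf_compl_eq_bot inf_le_left h0))
  obtain ⟨p, hp⟩ := exists_mem h0
  have ha := mem_of_le inf_le_left hp
  refine p.bot_notMem ?_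
  rw [← MOL.inf_compl (a ⊓ b)]
  exact inf_mem (inf_mem ha (h ha)) (mem_of_le inf_le_right hp)

theorem basic_injective : Function.Injective (basic (L := L)) := fun _ _ h =>
  le_antisymm (basic_subset_iff.1 h.subset) (basic_subset_iff.1 h.superset)

/-- A point `p` outside both sets is projected from `b` onto `a`, giving `q`, and then from `q` onto
`b`, giving `r`; it lies on the line through `q` and `r`. -/
theorem basic_sup_subset_of_disjoint {a b : L} (hab : a ⊓ b = ⊥) :
    basic (a ⊔ b) ⊆ collSpan Coll (basic a ∪ basic b) := by
  intro p hp
  by_cases hpa : a ∈ p.toSet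
  · exact subset_collSpan _ (Or.inl hpa)
  by_cases hpb : b ∈ p.toSet
  · exact subset_collSpan _ (Or.inr hpb)
  have hd := disjoint_principal hab
  rw [basic, Set.mem_ofPred_eq, ← atom_le_principal, principal_sup] at hp
  rw [← atom_le_principal] at hpa hpb
  obtain ⟨hq, hqs⟩ := p.isAtom_atom.project hpb hd hp
  obtain ⟨q, hq'⟩ := exists_atom_eq hq
  rw [← hq'] at hqs
  have hqa : q.atom ≤ toDual (PFilter.principal a) := hq'.le.trans inf_le_left
  have hpq : p ≠ q := fun h => hpa (h ▸ hqa)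
  obtain ⟨hr, hrs⟩ := p.isAtom_atom.project (a := toDual (PFilter.principal b)) (b := q.atom)
    (fun h => hpq (atom_le_iff_eq.1 h)) (hd.symm.mono_right hqa)
    (le_sup_left.trans (hqs.symm.le.trans (sup_comm _ _).le))
  obtain ⟨r, hr'⟩ := exists_atom_eq hr
  rw [← hr'] at hrs
  have hrb : r.atom ≤ toDual (PFilter.principal b) := hr'.le.trans inf_le_left
  have hpr : p ≠ r := fun h => hpb (h ▸ hrb)
  have hrq : r ≠ q := by
    rintro rfl
    exact r.isAtom_atom.1 (le_bot_iff.1 (hd hqa hrb))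
  refine isCollClosed_collSpan _ r (subset_collSpan _ (Or.inr (atom_le_principal.1 hrb))) q
    (subset_collSpan _ (Or.inl (atom_le_principal.1 hqa))) p ?_
  exact coll_iff.2 ⟨hrq, hpr.symm, hpq.symm, le_sup_left.trans hrs.symm.le⟩

theorem basic_sup (a b : L) : basic (a ⊔ b) = collSpan Coll (basic a ∪ basic b) := by
  apply Set.Subset.antisymm
  · have h0 : (a ⊓ (a ⊓ b)ᶜ) ⊓ b = ⊥ := by
      rw [inf_right_comm, MOL.inf_compl]
    have h1 : a ⊔ b ≤ (a ⊓ (a ⊓ b)ᶜ) ⊔ b := by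
      refine sup_le ?_ le_sup_right
      rw [← MOL.sup_inf_compl_of_le (inf_le_left : a ⊓ b ≤ a)]
      refine sup_le (inf_le_right.trans le_sup_right) ?_
      rw [MOL.sup_inf_compl_of_le (inf_le_left : a ⊓ b ≤ a)]
      exact le_sup_left
    exact (basic_mono h1).trans ((basic_sup_subset_of_disjoint h0).trans
      (collSpan_mono (Set.union_subset_union_left _ (basic_mono inf_le_left))))
  · exact collSpan_subset (isCollClosed_basic _)
      (Set.union_subset (basic_mono le_sup_left) (basic_mono le_sup_right))

theorem basic_compl (a : L) : basic aᶜ = (frinkSpace L).perp (basic a) := by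
  apply Set.Subset.antisymm
  · exact fun q hq p hp => ⟨aᶜ, hq, a, hp, le_rfl⟩
  · intro q hq
    by_contra hqa
    replace hqa : ¬ q.atom ≤ toDual (PFilter.principal aᶜ) := fun h => hqa (atom_le_principal.1 h)
    -- Let `p` be the projection of `q` from `aᶜ` onto `a`. If `q ⟂ p` is witnessed by `c ≤ bᶜ`,
    -- then `p ≤ q ⊔ aᶜ ≤ (b ⊓ a)ᶜ`, while `p` also contains `b ⊓ a`.
    obtain ⟨hp, hps⟩ := q.isAtom_atom.project hqa (disjoint_principal (MOL.inf_compl a))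
      (by rw [← principal_sup, MOL.sup_compl, atom_le_principal]; exact q.top_mem)
    obtain ⟨p, hp'⟩ := exists_atom_eq hp
    rw [← hp'] at hps
    have hpa : a ∈ p.toSet := atom_le_principal.1 (hp'.le.trans inf_le_left)
    obtain ⟨c, hc, b, hb, hcb⟩ := hq p hpa
    refine p.bot_notMem ?_
    rw [← MOL.inf_compl (b ⊓ a)]
    refine inf_mem (inf_mem hb hpa) ?_
    rw [← atom_le_principal]
    refine le_sup_left.trans (hps.le.trans (sup_le ?_ ?_))
    · rw [atom_le_principal]
      exact mem_of_le (hcb.trans (MOL.compl_anti _ _ inf_le_left)) hc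
    · exact PFilter.principal_le_principal_iff.2 (MOL.compl_anti _ _ inf_le_right)

/-! ### Topology, s-compactness and the Frinkian conditions. -/

theorem basic_mem_opens (a : L) : basic a ∈ (frinkSpace L).opens :=
  ⟨{a}, by simpa using (collSpan_eq (isCollClosed_basic a)).symm⟩

/-- Open subspaces are unions of the basic ones over an ideal. -/
theorem exists_ideal_of_mem_opens {V : Set (FrinkPoint L)} (hV : V ∈ (frinkSpace L).opens) :
    ∃ I : Ideal L, V = ⋃ a ∈ I, basic a := by
  obtain ⟨A, rfl⟩ := hV
  let W := collSpan Coll (⋃ a ∈ A, basic a)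
  -- By `basic_sup` the elements whose basic set lies in the span form an ideal. Directedness makes
  -- the union over it closed already, so no further span is needed.
  let I : Ideal L :=
    { carrier := {a | basic a ⊆ W}
      lower' := fun a b hba ha => (basic_mono hba).trans ha
      nonempty' := ⟨⊥, by simp [basic_bot]⟩
      directed' := fun a ha b hb => ⟨a ⊔ b, by
        rw [Set.mem_ofPred_eq, basic_sup]
        exact collSpan_subset (isCollClosed_collSpan _) (Set.union_subset ha hb),
        le_sup_left, le_sup_right⟩ }
  refine ⟨I, Set.Subset.antisymm (collSpan_subset ?_ ?_) ?_⟩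
  · intro p hp q hq r hr
    simp only [Set.mem_iUnion] at hp hq ⊢
    obtain ⟨a, ha, hpa⟩ := hp
    obtain ⟨b, hb, hqb⟩ := hq
    exact ⟨a ⊔ b, Ideal.sup_mem ha hb, isCollClosed_basic _ p (basic_mono le_sup_left hpa) q
      (basic_mono le_sup_right hqb) r hr⟩
  · refine Set.iUnion₂_subset fun a ha => ?_
    have : a ∈ I := (Set.subset_iUnion₂ (s := fun a _ => basic a) a ha).trans (subset_collSpan _)
    exact Set.subset_iUnion₂ (s := fun a (_ : a ∈ I) => basic a) a this
  · exact Set.iUnion₂_subset fun a ha => ha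

theorem exists_basic_subset {V : Set (FrinkPoint L)} (hV : V ∈ (frinkSpace L).opens)
    {p : FrinkPoint L} (hp : p ∈ V) : ∃ a ∈ p.toSet, basic a ⊆ V := by
  obtain ⟨I, rfl⟩ := exists_ideal_of_mem_opens hV
  simp only [Set.mem_iUnion] at hp
  obtain ⟨a, ha, hpa⟩ := hp
  exact ⟨a, hpa, Set.subset_iUnion₂ (s := fun a (_ : a ∈ I) => basic a) a ha⟩

theorem isSubspaceTopology : (frinkSpace L).IsSubspaceTopology := by
  have hsub : ∀ U ∈ (frinkSpace L).opens, (frinkSpace L).IsSubspace U := by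
    rintro _ ⟨A, rfl⟩
    exact isCollClosed_collSpan _
  have hsup : ∀ S ⊆ (frinkSpace L).opens, (frinkSpace L).span (⋃₀ S) ∈ (frinkSpace L).opens := by
    intro S hS
    refine ⟨{a | ∃ U ∈ S, basic a ⊆ U}, Set.Subset.antisymm
      (collSpan_mono ?_) (collSpan_mono ?_)⟩
    · rintro p ⟨U, hU, hpU⟩
      obtain ⟨a, hpa, ha⟩ := exists_basic_subset (hS hU) hpU
      exact Set.mem_iUnion₂.2 ⟨a, ⟨U, hU, ha⟩, hpa⟩
    · refine Set.iUnion₂_subset ?_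
      rintro a ⟨U, hU, ha⟩
      exact ha.trans (Set.subset_sUnion_of_mem hU)
  refine ⟨hsub, basic_bot (L := L) ▸ basic_mem_opens ⊥, basic_top (L := L) ▸ basic_mem_opens ⊤, ?_, ?_, hsup⟩
  · intro U hU V hV
    refine ⟨{a | basic a ⊆ U ∩ V}, Set.Subset.antisymm ?_ ?_⟩
    · refine Set.Subset.trans ?_ (subset_collSpan _)
      rintro p ⟨hpU, hpV⟩
      obtain ⟨a, hpa, ha⟩ := exists_basic_subset hU hpU
      obtain ⟨b, hpb, hb⟩ := exists_basic_subset hV hpV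
      refine Set.mem_iUnion₂.2 ⟨a ⊓ b, ?_, inf_mem hpa hpb⟩
      rw [Set.mem_ofPred_eq, basic_inf]
      exact Set.inter_subset_inter ha hb
    · exact collSpan_subset ((hsub U hU).inter (hsub V hV)) (Set.iUnion₂_subset fun a ha => ha)
  · intro U hU V hV
    have := hsup {U, V} (Set.insert_subset hU (Set.singleton_subset_iff.2 hV))
    rwa [Set.sUnion_pair] at this

theorem isSBasis : (frinkSpace L).IsSBasis (Set.range (basic (L := L))) where
  subset_opens := by rintro _ ⟨a, rfl⟩; exact basic_mem_opens a
  empty_mem := ⟨⊥, basic_bot⟩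
  inter_mem := by rintro _ ⟨a, rfl⟩ _ ⟨b, rfl⟩; exact ⟨a ⊓ b, basic_inf a b⟩
  join_mem := by rintro _ ⟨a, rfl⟩ _ ⟨b, rfl⟩; exact ⟨a ⊔ b, basic_sup a b⟩
  exists_directed U hU := by
    obtain ⟨I, rfl⟩ := exists_ideal_of_mem_opens hU
    refine ⟨basic '' (I : Set L), Set.image_subset_range _ _, ⟨?_, ?_, ?_⟩, ?_⟩
    · rintro _ ⟨a, -, rfl⟩
      exact basic_mem_opens a
    · exact I.nonempty.image _
    · rintro _ ⟨a, ha, rfl⟩ _ ⟨b, hb, rfl⟩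
      exact ⟨_, ⟨a ⊔ b, Ideal.sup_mem ha hb, rfl⟩, basic_mono le_sup_left,
        basic_mono le_sup_right⟩
    · simp [Set.sUnion_image]

theorem exists_basic_of_isDirectedSystem {D : Set (Set (FrinkPoint L))}
    (hD : (frinkSpace L).IsDirectedSystem D) {a b : L} (ha : ∃ U ∈ D, basic a ⊆ U)
    (hb : ∃ U ∈ D, basic b ⊆ U) : ∃ U ∈ D, basic (a ⊔ b) ⊆ U := by
  obtain ⟨U, hU, haU⟩ := ha
  obtain ⟨V, hV, hbV⟩ := hb
  obtain ⟨W, hW, hUW, hVW⟩ := hD.directed U hU V hV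
  refine ⟨W, hW, ?_⟩
  rw [basic_sup]
  exact collSpan_subset (isSubspaceTopology.isSubspace W (hD.subset_opens hW))
    (Set.union_subset (haU.trans hUW) (hbV.trans hVW))

/-- If no basic set below `a` in the directed system is all of `U(a)`, some point of `U(a)` is
orthogonal to all of these basic sets. -/
theorem exists_mem_of_isDirectedSystem {D : Set (Set (FrinkPoint L))}
    (hD : (frinkSpace L).IsDirectedSystem D) (a : L) (ha : ¬ ∃ U ∈ D, basic a ⊆ U) :
    ∃ p ∈ basic a, ∀ b ≤ a, (∃ U ∈ D, basic b ⊆ U) → bᶜ ∈ p.toSet := by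
  obtain ⟨U₀, hU₀⟩ := hD.nonempty
  have hbot : ∃ U ∈ D, basic (⊥ : L) ⊆ U := ⟨U₀, hU₀, by simp [basic_bot]⟩
  obtain ⟨p, hp⟩ := exists_superset
    (S := {x | ∃ b, b ≤ a ∧ (∃ U ∈ D, basic b ⊆ U) ∧ x = a ⊓ bᶜ}) ⟨_, ⊥, bot_le, hbot, rfl⟩
    (by
      rintro _ ⟨b, hb, hbD, rfl⟩ _ ⟨c, hc, hcD, rfl⟩
      exact ⟨_, ⟨b ⊔ c, sup_le hb hc, exists_basic_of_isDirectedSystem hD hbD hcD, rfl⟩,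
        inf_le_inf_left _ (MOL.compl_anti _ _ le_sup_left),
        inf_le_inf_left _ (MOL.compl_anti _ _ le_sup_right)⟩)
    -- If `a ⊓ bᶜ = ⊥` with `b ≤ a`, then `b = a`, against the hypothesis on `a`.
    (by
      rintro ⟨b, hb, hbD, h⟩
      exact ha (MOL.eq_of_le_of_inf_compl_eq_bot hb h.symm ▸ hbD))
  exact ⟨p, mem_of_le inf_le_left (hp ⟨⊥, bot_le, hbot, rfl⟩),
    fun b hb hbD => mem_of_le inf_le_right (hp ⟨b, hb, hbD, rfl⟩)⟩

theorem isSCompact_basic (a : L) : (frinkSpace L).IsSCompact (basic a) := by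
  intro D hD hcov
  by_contra hno
  obtain ⟨p, hpa, hp⟩ := exists_mem_of_isDirectedSystem hD a hno
  obtain ⟨U, hU, hpU⟩ := hcov hpa
  obtain ⟨b, hpb, hb⟩ := exists_basic_subset (hD.subset_opens hU) hpU
  have h1 := hp (a ⊓ b) inf_le_left ⟨U, hU, (basic_mono inf_le_right).trans hb⟩
  refine p.bot_notMem ?_
  rw [← MOL.inf_compl (a ⊓ b)]
  exact inf_mem (inf_mem hpa hpb) h1

theorem isMOLSpace : (frinkSpace L).IsMOLSpace where
  projective := isProjective
  orthogonality := isAnisotropicOrthogonality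
  topology := isSubspaceTopology
  sCompact := basic_top (L := L) ▸ isSCompact_basic ⊤
  exists_basis := by
    refine ⟨_, isSBasis, ?_, ?_⟩
    · rintro _ ⟨a, rfl⟩
      rw [← basic_compl]
      refine ⟨basic_mem_opens _, ?_⟩
      rw [← basic_top, ← MOL.sup_compl a, basic_sup]
      rfl
    · rintro p q ⟨a, ha, b, hb, h⟩
      refine ⟨_, ⟨bᶜ, rfl⟩, mem_of_le h ha, ?_⟩
      rw [← basic_compl, MOL.compl_compl]
      exact hb

/-- Induction: a point below `q` joined with the earlier atoms is projected from `q` onto their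
join, and it lies on the line through `q` and its projection. -/
theorem mem_span_of_atom_le_sup (F : Finset (FrinkPoint L)) :
    ∀ p : FrinkPoint L, p.atom ≤ F.sup atom → p ∈ (frinkSpace L).span (F : Set (FrinkPoint L)) := by
  classical
  induction F using Finset.induction_on with
  | empty => exact fun p h => (p.isAtom_atom.1 (le_bot_iff.1 h)).elim
  | insert q F _ ih =>
    intro p hp
    have hmono : (frinkSpace L).span (F : Set (FrinkPoint L)) ⊆
        (frinkSpace L).span ((insert q F : Finset _) : Set (FrinkPoint L)) :=
      collSpan_mono (by simp)
    have hq : q ∈ (frinkSpace L).span ((insert q F : Finset _) : Set (FrinkPoint L)) :=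
      subset_collSpan _ (by simp)
    rw [Finset.sup_insert] at hp
    by_cases hqF : q.atom ≤ F.sup atom
    · exact hmono (ih p (hp.trans (sup_le hqF le_rfl)))
    by_cases hpq : p = q
    · exact hpq ▸ hq
    obtain ⟨hr, hrs⟩ := p.isAtom_atom.project (a := F.sup atom) (b := q.atom)
      (fun h => hpq (atom_le_iff_eq.1 h)) (q.isAtom_atom.not_le_iff_disjoint.1 hqF).symm
      (hp.trans (sup_comm _ _).le)
    obtain ⟨r, hr'⟩ := exists_atom_eq hr
    rw [← hr'] at hrs
    have hrF : r.atom ≤ F.sup atom := hr'.le.trans inf_le_left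
    have hrmem := hmono (ih r hrF)
    by_cases hpr : p = r
    · exact hpr ▸ hrmem
    · refine isCollClosed_collSpan _ r hrmem q hq p (coll_iff.2 ⟨?_, Ne.symm hpr, Ne.symm hpq,
        le_sup_left.trans hrs.symm.le⟩)
      rintro rfl
      exact hqF hrF

theorem mem_toSet_of_mem_sup {F : Finset (FrinkPoint L)} {b : L} (hb : b ∈ ofDual (F.sup atom))
    {q : FrinkPoint L} (hq : q ∈ F) : b ∈ q.toSet :=
  (show ofDual (F.sup atom) ≤ q.1 from Finset.le_sup (f := atom) hq) hb

/-- An atom outside the span is disjoint from the finite join, so the corresponding filters generate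
`⊥`, already as a meet of one element from each. -/
theorem isStronglyHausdorff : (frinkSpace L).IsStronglyHausdorff := by
  intro p F hp
  have hd := p.isAtom_atom.not_le_iff_disjoint.1 fun h => hp (mem_span_of_atom_le_sup F p h)
  have hbot : (⊥ : L) ∈ p.1 ⊔ ofDual (F.sup atom) :=
    disjoint_iff_inf_le.1 hd (PFilter.mem_top (⊥ : L))
  obtain ⟨a, ha, b, hb, hab⟩ := PFilter.mem_sup.1 hbot
  refine ⟨basic a, basic_mem_opens a, basic b, basic_mem_opens b, ha, ?_, ?_⟩
  · exact fun q hq => mem_toSet_of_mem_sup hb hq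
  · rw [← basic_inf, le_bot_iff.1 hab, basic_bot]

theorem isFrinkian : (frinkSpace L).IsFrinkian where
  molSpace := isMOLSpace
  stronglyHausdorff := isStronglyHausdorff
  univ_mem_of_dense D hD h := by
    have : ∃ U ∈ D, basic (⊤ : L) ⊆ U := by
      by_contra hno
      obtain ⟨p, -, hp⟩ := exists_mem_of_isDirectedSystem hD ⊤ hno
      have hperp : p ∈ (frinkSpace L).perp (⋃₀ D) := by
        rintro q ⟨U, hU, hqU⟩
        obtain ⟨b, hqb, hb⟩ := exists_basic_subset (hD.subset_opens hU) hqU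
        exact ⟨bᶜ, hp b le_top ⟨U, hU, hb⟩, b, hqb, le_rfl⟩
      exact isAnisotropicOrthogonality.aniso p (h.superset (Set.mem_univ p) p hperp)
    obtain ⟨U, hU, h⟩ := this
    rw [basic_top, Set.univ_subset_iff] at h
    exact h ▸ hU

theorem isIsoOntoSCompactOpens :
    (frinkSpace L).IsIsoOntoSCompactOpens (basic (L := L)) where
  injective := basic_injective
  range_eq := by
    apply Set.Subset.antisymm
    · rintro _ ⟨a, rfl⟩
      exact ⟨basic_mem_opens a, isSCompact_basic a⟩
    · rintro U ⟨hU, hc⟩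
      obtain ⟨D, hDB, hD, rfl⟩ := isSBasis.exists_directed U hU
      obtain ⟨V, hV, hUV⟩ := hc D hD subset_rfl
      rw [hUV.antisymm (Set.subset_sUnion_of_mem hV)]
      exact hDB hV
  map_bot := basic_bot
  map_top := basic_top
  map_inf := basic_inf
  map_sup := basic_sup
  map_compl := basic_compl

end FrinkPoint

/-! ### Joins of subspaces in a projective space. -/

namespace OrthoSpace

variable {P : Type u} {X : OrthoSpace P}

namespace IsProjective

theorem coll_of_coll_of_coll (h : X.IsProjective) {x y z w : P} (hz : X.Coll x y z)
    (hw : X.Coll x y w) (hzw : z ≠ w) : X.Coll x z w := by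
  by_contra hn
  -- The triangle axiom with `s = t = y` would give a collinear triplet with `y` repeated.
  obtain ⟨u, ⟨-, hu⟩, -⟩ := h.triangle z x w y y (h.swap _ _ _ (h.rotate _ _ _ hz)) hw hzw
    (fun hc => hn (h.swap _ _ _ hc))
  exact h.ne _ _ _ hu rfl

theorem isSubspace_singleton (h : X.IsProjective) (p : P) : X.IsSubspace {p} := by
  rintro _ rfl _ rfl r hr
  exact (h.ne _ _ _ hr rfl).elim

/-- The points on lines joining `A` and `B`. -/
def _root_.OrthoSpace.lineJoin (X : OrthoSpace P) (A B : Set P) : Set P :=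
  {x | x ∈ A ∨ x ∈ B ∨ ∃ a ∈ A, ∃ b ∈ B, X.Coll a b x}

theorem lineJoin_comm (h : X.IsProjective) (A B : Set P) : X.lineJoin A B = X.lineJoin B A := by
  have key : ∀ A B : Set P, X.lineJoin A B ⊆ X.lineJoin B A := by
    rintro A B x (hx | hx | ⟨a, ha, b, hb, hx⟩)
    · exact Or.inr (Or.inl hx)
    · exact Or.inl hx
    · exact Or.inr (Or.inr ⟨b, hb, a, ha, h.swap _ _ _ hx⟩)
  exact (key A B).antisymm (key B A)

theorem mem_lineJoin_of_coll_left (h : X.IsProjective) {A B : Set P} (hA : X.IsSubspace A)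
    {p q r : P} (hp : p ∈ A) (hq : q ∈ X.lineJoin A B) (hr : X.Coll p q r) :
    r ∈ X.lineJoin A B := by
  rcases hq with hq | hq | ⟨a, ha, b, hb, hq⟩
  · exact Or.inl (hA p hp q hq r hr)
  · exact Or.inr (Or.inr ⟨p, hp, q, hq, hr⟩)
  · have hqba : X.Coll q b a := h.rotate _ _ _ (h.rotate _ _ _ (h.swap _ _ _ hq))
    by_cases hpa : p = a
    · subst hpa
      by_cases hbr : b = r
      · exact Or.inr (Or.inl (hbr ▸ hb))
      · refine Or.inr (Or.inr ⟨p, hp, b, hb, h.coll_of_coll_of_coll ?_ hr hbr⟩)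
        exact h.swap _ _ _ (h.rotate _ _ _ (h.rotate _ _ _ hq))
    · by_cases hc : X.Coll p q a
      · have hqA : q ∈ A := hA p hp a ha q (h.rotate _ _ _ (h.swap _ _ _ hc))
        exact Or.inl (hA p hp q hqA r hr)
      -- The line through `r` and `b` cuts two sides of the triangle `p`, `q`, `a`, hence meets the
      -- third side in a point `u` of `A`.
      · obtain ⟨u, ⟨hu1, hu2⟩, -⟩ := h.triangle p q a r b
          (h.swap _ _ _ (h.rotate _ _ _ (h.rotate _ _ _ hr))) hqba hpa hc
        exact Or.inr (Or.inr ⟨u, hA p hp a ha u hu1, b, hb,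
          h.swap _ _ _ (h.rotate _ _ _ hu2)⟩)

theorem mem_lineJoin_of_coll_right (h : X.IsProjective) {A B : Set P} (hB : X.IsSubspace B)
    {p q r : P} (hp : p ∈ B) (hq : q ∈ X.lineJoin A B) (hr : X.Coll p q r) :
    r ∈ X.lineJoin A B := by
  rw [h.lineJoin_comm] at hq ⊢
  exact h.mem_lineJoin_of_coll_left hB hp hq hr

theorem isSubspace_lineJoin (h : X.IsProjective) {A B : Set P} (hA : X.IsSubspace A)
    (hB : X.IsSubspace B) : X.IsSubspace (X.lineJoin A B) := by
  intro p hp q hq r hr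
  rcases id hp with hp' | hp' | ⟨a, ha, b, hb, hab⟩
  · exact h.mem_lineJoin_of_coll_left hA hp' hq hr
  · exact h.mem_lineJoin_of_coll_right hB hp' hq hr
  by_cases hqa : q = a
  · exact h.mem_lineJoin_of_coll_left hA (hqa ▸ ha : q ∈ A) hp (h.swap _ _ _ hr)
  by_cases hc : X.Coll q p a
  · by_cases har : a = r
    · exact Or.inl (har ▸ ha)
    · have := h.coll_of_coll_of_coll hc (h.swap _ _ _ hr) har
      exact h.mem_lineJoin_of_coll_left hA ha hq (h.swap _ _ _ this)
  · obtain ⟨u, ⟨hu1, hu2⟩, -⟩ := h.triangle q p a r b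
      (h.rotate _ _ _ hr) (h.swap _ _ _ (h.rotate _ _ _ hab)) hqa hc
    have hu : u ∈ X.lineJoin A B := h.mem_lineJoin_of_coll_left hA ha hq (h.swap _ _ _ hu1)
    exact h.mem_lineJoin_of_coll_right hB hb hu (h.rotate _ _ _ hu2)

theorem join_eq_lineJoin (h : X.IsProjective) {A B : Set P} (hA : X.IsSubspace A)
    (hB : X.IsSubspace B) : X.join A B = X.lineJoin A B := by
  apply Set.Subset.antisymm
  · exact collSpan_subset (h.isSubspace_lineJoin hA hB)
      (Set.union_subset (fun x hx => Or.inl hx) (fun x hx => Or.inr (Or.inl hx)))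
  · rintro x (hx | hx | ⟨a, ha, b, hb, hx⟩)
    · exact subset_collSpan _ (Or.inl hx)
    · exact subset_collSpan _ (Or.inr hx)
    · exact isCollClosed_collSpan _ a (subset_collSpan _ (Or.inl ha)) b
        (subset_collSpan _ (Or.inr hb)) x hx

/-- The modular law for subspaces of a projective space. -/
theorem join_inter_subset (h : X.IsProjective) {A B C : Set P} (hA : X.IsSubspace A)
    (hB : X.IsSubspace B) (hC : X.IsSubspace C) (hAC : A ⊆ C) :
    X.join A B ∩ C ⊆ X.join A (B ∩ C) := by
  rw [h.join_eq_lineJoin hA hB, h.join_eq_lineJoin hA (hB.inter hC)]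
  rintro x ⟨hx | hx | ⟨a, ha, b, hb, hx⟩, hxC⟩
  · exact Or.inl hx
  · exact Or.inr (Or.inl ⟨hx, hxC⟩)
  · refine Or.inr (Or.inr ⟨a, ha, b, ⟨hb, ?_⟩, hx⟩)
    exact hC x hxC a (hAC ha) b (h.rotate _ _ _ (h.rotate _ _ _ hx))

end IsProjective

theorem left_subset_join (U V : Set P) : U ⊆ X.join U V :=
  Set.subset_union_left.trans (subset_collSpan _)

theorem right_subset_join (U V : Set P) : V ⊆ X.join U V :=
  Set.subset_union_right.trans (subset_collSpan _)

theorem join_subset {U V W : Set P} (hW : X.IsSubspace W) (hU : U ⊆ W) (hV : V ⊆ W) :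
    X.join U V ⊆ W := collSpan_subset hW (Set.union_subset hU hV)

theorem perp_anti {U V : Set P} (h : U ⊆ V) : X.perp V ⊆ X.perp U := fun _ hq p hp => hq p (h hp)

namespace IsAnisotropicOrthogonality

theorem isSubspace_perp (h : X.IsAnisotropicOrthogonality) (U : Set P) :
    X.IsSubspace (X.perp U) :=
  fun p hp q hq r hr u hu =>
    h.symm _ _ (h.coll u p q r (h.symm _ _ (hp u hu)) (h.symm _ _ (hq u hu)) hr)

theorem inter_perp (h : X.IsAnisotropicOrthogonality) (U : Set P) : U ∩ X.perp U = ∅ :=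
  Set.eq_empty_of_forall_notMem fun p hp => h.aniso p (hp.2 p hp.1)

theorem subset_perp_perp (h : X.IsAnisotropicOrthogonality) (U : Set P) :
    U ⊆ X.perp (X.perp U) := fun p hp _ hq => h.symm _ _ (hq p hp)

end IsAnisotropicOrthogonality

theorem join_empty {U : Set P} (hU : X.IsSubspace U) : X.join U ∅ = U := by
  rw [join, Set.union_empty]
  exact collSpan_eq hU

/-! ### The MOL of s-compact open subspaces. -/

namespace IsMOLSpace

theorem perp_perp (h : X.IsMOLSpace) {U : Set P} (hU : X.IsSubspace U)
    (hjoin : X.join U (X.perp U) = Set.univ) : X.perp (X.perp U) = U := by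
  refine Set.Subset.antisymm (fun x hx => ?_) (h.orthogonality.subset_perp_perp U)
  have := h.projective.join_inter_subset hU (h.orthogonality.isSubspace_perp U)
    (h.orthogonality.isSubspace_perp (X.perp U)) (h.orthogonality.subset_perp_perp U)
    ⟨hjoin ▸ Set.mem_univ x, hx⟩
  rwa [h.orthogonality.inter_perp, join_empty hU] at this

/-- Complemented open subspaces are s-compact. -/
theorem isSCompact_of_isCompl (h : X.IsMOLSpace) {U V : Set P} (hU : U ∈ X.opens)
    (hV : V ∈ X.opens) (hd : U ∩ V = ∅) (hj : X.join U V = Set.univ) : X.IsSCompact U := by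
  have hsub := h.topology.isSubspace
  intro D hD hcov
  -- Adding `V` turns a cover of `U` into a cover of the whole space. Cutting down to `W ∩ U` first
  -- lets the modular law remove `V` again.
  let D' : Set (Set P) := (fun W => X.join (W ∩ U) V) '' D
  have hmono : ∀ {W W' : Set P}, W ⊆ W' → X.join (W ∩ U) V ⊆ X.join (W' ∩ U) V :=
    fun hW => collSpan_mono (Set.union_subset_union_left _ (Set.inter_subset_inter_left _ hW))
  have hD' : X.IsDirectedSystem D' := by
    refine ⟨?_, hD.nonempty.image _, ?_⟩
    · rintro _ ⟨W, hW, rfl⟩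
      exact h.topology.join_mem _ (h.topology.inter_mem _ (hD.subset_opens hW) _ hU) _ hV
    · rintro _ ⟨W, hW, rfl⟩ _ ⟨W', hW', rfl⟩
      obtain ⟨W'', hW'', h1, h2⟩ := hD.directed W hW W' hW'
      exact ⟨_, ⟨W'', hW'', rfl⟩, hmono h1, hmono h2⟩
  have hcov' : Set.univ ⊆ ⋃₀ D' := by
    rw [← hj]
    refine join_subset (isCollClosed_sUnion_of_directedOn hD'.directed
      fun W hW => hsub W (hD'.subset_opens hW)) ?_ ?_
    · intro x hx
      obtain ⟨W, hW, hxW⟩ := hcov hx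
      exact ⟨_, ⟨W, hW, rfl⟩, left_subset_join _ _ ⟨hxW, hx⟩⟩
    · obtain ⟨W, hW⟩ := hD.nonempty
      exact fun x hx => ⟨_, ⟨W, hW, rfl⟩, right_subset_join _ _ hx⟩
  obtain ⟨_, ⟨W, hW, rfl⟩, huniv⟩ := h.sCompact D' hD' hcov'
  have hWU : X.IsSubspace (W ∩ U) := (hsub W (hD.subset_opens hW)).inter (hsub U hU)
  refine ⟨W, hW, fun x hx => ?_⟩
  have := h.projective.join_inter_subset hWU (hsub V hV) (hsub U hU)
    Set.inter_subset_right ⟨huniv (Set.mem_univ x), hx⟩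
  rw [Set.inter_comm V, hd, join_empty hWU] at this
  exact this.1

/-- The s-compact open subspaces are the only basis as required in an MOL-space. -/
theorem sCompactOpens_basis (h : X.IsMOLSpace) :
    X.IsSBasis {U | U ∈ X.opens ∧ X.IsSCompact U} ∧
    (∀ U ∈ X.opens, X.IsSCompact U → X.perp U ∈ X.opens ∧ X.join U (X.perp U) = Set.univ) ∧
    (∀ p q, X.Orth p q → ∃ U ∈ X.opens, X.IsSCompact U ∧ p ∈ U ∧ q ∈ X.perp U) := by
  obtain ⟨B, hB, hperp, horth⟩ := h.exists_basis
  have hBeq : B = {U | U ∈ X.opens ∧ X.IsSCompact U} := by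
    -- Basic members are s-compact because they are complemented; an s-compact open is a directed
    -- union of basic members, hence equal to one of them.
    apply Set.Subset.antisymm
    · exact fun U hU => ⟨hB.subset_opens hU, h.isSCompact_of_isCompl (hB.subset_opens hU)
        (hperp U hU).1 (h.orthogonality.inter_perp U) (hperp U hU).2⟩
    · rintro U ⟨hU, hc⟩
      obtain ⟨D, hDB, hD, rfl⟩ := hB.exists_directed U hU
      obtain ⟨V, hV, hUV⟩ := hc D hD subset_rfl
      rw [hUV.antisymm (Set.subset_sUnion_of_mem hV)]
      exact hDB hV
  subst hBeq
  refine ⟨hB, fun U hU hc => hperp U ⟨hU, hc⟩, fun p q hpq => ?_⟩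
  obtain ⟨U, hU, hp, hq⟩ := horth p q hpq
  exact ⟨U, hU.1, hU.2, hp, hq⟩

theorem perp_perp_of_isSCompact (h : X.IsMOLSpace) {U : Set P} (hU : U ∈ X.opens)
    (hc : X.IsSCompact U) : X.perp (X.perp U) = U :=
  h.perp_perp (h.topology.isSubspace U hU) (h.sCompactOpens_basis.2.1 U hU hc).2

theorem isSCompact_perp (h : X.IsMOLSpace) {U : Set P} (hU : U ∈ X.opens)
    (hc : X.IsSCompact U) : X.IsSCompact (X.perp U) := by
  obtain ⟨hperp, hjoin⟩ := h.sCompactOpens_basis.2.1 U hU hc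
  refine h.isSCompact_of_isCompl hperp hU ?_ ?_
  · rw [Set.inter_comm, h.orthogonality.inter_perp]
  · rw [join, Set.union_comm]
    exact hjoin

end IsMOLSpace

theorem SCompactOpen.carrier_injective :
    Function.Injective (SCompactOpen.carrier (X := X)) := by
  rintro ⟨U, _, _⟩ ⟨V, _, _⟩ rfl
  rfl

instance : PartialOrder X.SCompactOpen := PartialOrder.lift _ SCompactOpen.carrier_injective

/-- The MOL of s-compact open subspaces. -/
@[reducible]
def IsMOLSpace.mol (h : X.IsMOLSpace) : MOL X.SCompactOpen where
  __ := (inferInstance : PartialOrder X.SCompactOpen)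
  sup U V := ⟨X.join U.carrier V.carrier,
    h.topology.join_mem _ U.isOpen _ V.isOpen, (h.sCompactOpens_basis.1.join_mem _
      ⟨U.isOpen, U.isSCompact⟩ _ ⟨V.isOpen, V.isSCompact⟩).2⟩
  inf U V := ⟨U.carrier ∩ V.carrier,
    h.topology.inter_mem _ U.isOpen _ V.isOpen, (h.sCompactOpens_basis.1.inter_mem _
      ⟨U.isOpen, U.isSCompact⟩ _ ⟨V.isOpen, V.isSCompact⟩).2⟩
  top := ⟨Set.univ, h.topology.univ_mem, h.sCompact⟩
  bot := ⟨∅, h.topology.empty_mem, h.sCompactOpens_basis.1.empty_mem.2⟩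
  compl U := ⟨X.perp U.carrier, (h.sCompactOpens_basis.2.1 _ U.isOpen U.isSCompact).1,
    h.isSCompact_perp U.isOpen U.isSCompact⟩
  le_sup_left _ _ := left_subset_join _ _
  le_sup_right _ _ := right_subset_join _ _
  sup_le _ _ W hU hV := join_subset (h.topology.isSubspace _ W.isOpen) hU hV
  inf_le_left _ _ := Set.inter_subset_left
  inf_le_right _ _ := Set.inter_subset_right
  le_inf _ _ _ h1 h2 := Set.subset_inter h1 h2
  le_top _ := Set.subset_univ _
  bot_le _ := Set.empty_subset _
  sup_inf_le_assoc_of_le {U} V {W} hUW :=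
    h.projective.join_inter_subset (h.topology.isSubspace _ U.isOpen)
      (h.topology.isSubspace _ V.isOpen) (h.topology.isSubspace _ W.isOpen) hUW
  sup_compl U := SCompactOpen.carrier_injective
    (h.sCompactOpens_basis.2.1 _ U.isOpen U.isSCompact).2
  inf_compl _ := SCompactOpen.carrier_injective (h.orthogonality.inter_perp _)
  compl_compl U := SCompactOpen.carrier_injective
    (h.perp_perp_of_isSCompact U.isOpen U.isSCompact)
  compl_anti _ _ hUV := perp_anti hUV

theorem IsMOLSpace.isIsoOntoSCompactOpens_carrier (h : X.IsMOLSpace) :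
    let _ := h.mol
    X.IsIsoOntoSCompactOpens (SCompactOpen.carrier (X := X)) := by
  let _ := h.mol
  refine ⟨SCompactOpen.carrier_injective, ?_, rfl, rfl, fun _ _ => rfl, fun _ _ => rfl,
    fun _ => rfl⟩
  ext U
  exact ⟨fun ⟨V, hV⟩ => hV ▸ ⟨V.isOpen, V.isSCompact⟩, fun hU => ⟨⟨U, hU.1, hU.2⟩, rfl⟩⟩

end OrthoSpace

/-! ### From a Frinkian space to the Frink space of its MOL. -/

namespace OrthoSpace

variable {P Q : Type u} {X : OrthoSpace P} {Y : OrthoSpace Q} {K L : Type u} [MOL K] [MOL L]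

namespace IsIsoOntoSCompactOpens

variable {φ : K → Set P}

theorem subset_iff (hφ : X.IsIsoOntoSCompactOpens φ) {a b : K} : φ a ⊆ φ b ↔ a ≤ b := by
  rw [← inf_eq_left (a := a), ← hφ.injective.eq_iff, hφ.map_inf, Set.inter_eq_left]

theorem mem_opens (hφ : X.IsIsoOntoSCompactOpens φ) (a : K) : φ a ∈ X.opens :=
  (hφ.range_eq.subset ⟨a, rfl⟩).1

theorem molIsomorphic {ψ : L → Set P} (hφ : X.IsIsoOntoSCompactOpens φ)
    (hψ : X.IsIsoOntoSCompactOpens ψ) : MOLIsomorphic K L := by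
  let e : K ≃ L := (Equiv.ofInjective φ hφ.injective).trans
    ((Equiv.setCongr (hφ.range_eq.trans hψ.range_eq.symm)).trans
      (Equiv.ofInjective ψ hψ.injective).symm)
  have he : ∀ a, ψ (e a) = φ a := fun a => Equiv.apply_ofInjective_symm hψ.injective _
  refine ⟨⟨e, fun {a b} => ?_⟩, fun a => hψ.injective ?_⟩
  · rw [← hψ.subset_iff, he, he, hφ.subset_iff]
  · change ψ (e aᶜ) = ψ (e a)ᶜ
    rw [he, hψ.map_compl, he, hφ.map_compl]

theorem comp_orderIso (hφ : X.IsIsoOntoSCompactOpens φ) (e : L ≃o K)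
    (he : ∀ a, e aᶜ = (e a)ᶜ) : X.IsIsoOntoSCompactOpens (φ ∘ e) where
  injective := hφ.injective.comp e.injective
  range_eq := by rw [e.surjective.range_comp, hφ.range_eq]
  map_bot := by simp [hφ.map_bot]
  map_top := by simp [hφ.map_top]
  map_inf a b := by simp [hφ.map_inf]
  map_sup a b := by simp [hφ.map_sup]
  map_compl a := by simp [he, hφ.map_compl]

theorem exists_of_mem_opens (hφ : X.IsIsoOntoSCompactOpens φ) (hX : X.IsMOLSpace) {U : Set P}
    (hU : U ∈ X.opens) {p : P} (hp : p ∈ U) : ∃ a, p ∈ φ a ∧ φ a ⊆ U := by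
  obtain ⟨D, hDB, -, rfl⟩ := hX.sCompactOpens_basis.1.exists_directed U hU
  obtain ⟨V, hV, hpV⟩ := hp
  obtain ⟨a, rfl⟩ := hφ.range_eq.superset (hDB hV)
  exact ⟨a, hpV, Set.subset_sUnion_of_mem hV⟩

theorem exists_separating (hφ : X.IsIsoOntoSCompactOpens φ) (hX : X.IsFrinkian) {p q : P}
    (hpq : p ≠ q) : ∃ a, p ∈ φ a ∧ q ∉ φ a := by
  obtain ⟨U, hU, V, -, hpU, hqV, hd⟩ := hX.stronglyHausdorff p {q} (by
    rw [span, Finset.coe_singleton,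
      collSpan_eq (hX.molSpace.projective.isSubspace_singleton q)]
    exact hpq)
  obtain ⟨a, hpa, ha⟩ := hφ.exists_of_mem_opens hX.molSpace hU hpU
  exact ⟨a, hpa, fun hq => (hd.subset ⟨ha hq, hqV (by simp)⟩).elim⟩

/-- This is the density condition read through complements: a point orthogonal to every `φ aᶜ` would
lie in every `φ a`, so the union of the `φ aᶜ` is dense and some `aᶜ` is `⊤`. -/
theorem bot_mem_of_iInter_eq_empty (hφ : X.IsIsoOntoSCompactOpens φ) (hX : X.IsFrinkian)
    {S : Set K} (hne : S.Nonempty) (hdir : DirectedOn (· ≥ ·) S)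
    (h : ∀ x, ∃ a ∈ S, x ∉ φ a) : ⊥ ∈ S := by
  have hD : X.IsDirectedSystem ((fun a => φ aᶜ) '' S) := by
    refine ⟨?_, hne.image _, ?_⟩
    · rintro _ ⟨a, -, rfl⟩
      exact hφ.mem_opens _
    · rintro _ ⟨a, ha, rfl⟩ _ ⟨b, hb, rfl⟩
      obtain ⟨c, hc, hac, hbc⟩ := hdir a ha b hb
      exact ⟨_, ⟨c, hc, rfl⟩, hφ.subset_iff.2 (MOL.compl_anti _ _ hac),
        hφ.subset_iff.2 (MOL.compl_anti _ _ hbc)⟩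
  have hempty : X.perp (⋃₀ ((fun a => φ aᶜ) '' S)) = ∅ := by
    refine Set.eq_empty_of_forall_notMem fun x hx => ?_
    obtain ⟨a, ha, hxa⟩ := h x
    apply hxa
    rw [← MOL.compl_compl a, hφ.map_compl]
    exact perp_anti (Set.subset_sUnion_of_mem (Set.mem_image_of_mem (fun a => φ aᶜ) ha)) hx
  obtain ⟨a, ha, hau⟩ := hX.univ_mem_of_dense _ hD (by
    rw [hempty]
    exact Set.eq_univ_of_forall fun _ _ hp => hp.elim)
  have : aᶜ = ⊤ := hφ.injective (hau.trans hφ.map_top.symm)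
  rwa [← MOL.compl_compl a, this, MOL.compl_top] at ha

/-- The filter of all elements whose image contains `p`. -/
def pointFilter (hφ : X.IsIsoOntoSCompactOpens φ) (p : P) : PFilter K :=
  PFilter.ofSet {a | p ∈ φ a} (hφ.map_top.superset (Set.mem_univ p))
    (fun a ha b hb => (hφ.map_inf a b).superset ⟨ha, hb⟩)
    (fun _ ha _ hab => hφ.subset_iff.2 hab ha)

theorem mem_pointFilter (hφ : X.IsIsoOntoSCompactOpens φ) {p : P} {a : K} :
    a ∈ hφ.pointFilter p ↔ p ∈ φ a := Iff.rfl

theorem pointFilter_ne_top (hφ : X.IsIsoOntoSCompactOpens φ) (p : P) : hφ.pointFilter p ≠ ⊤ := by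
  intro h
  have : ⊥ ∈ hφ.pointFilter p := h ▸ PFilter.mem_top ⊥
  exact hφ.map_bot.subset (hφ.mem_pointFilter.1 this)

theorem isCoatom_pointFilter (hφ : X.IsIsoOntoSCompactOpens φ) (hX : X.IsFrinkian) (p : P) :
    IsCoatom (hφ.pointFilter p) := by
  refine ⟨hφ.pointFilter_ne_top p, fun F hF => ?_⟩
  obtain ⟨hle, v, hv, hpv⟩ := SetLike.lt_iff_le_and_exists.1 hF
  rw [hφ.mem_pointFilter] at hpv
  have htop : ⊤ ∈ hφ.pointFilter p := PFilter.top_mem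
  -- Only `p` lies in every member of its filter, and `p` is not in `φ v`; so the sets `φ (u ⊓ v)`
  -- have no common point and some `u ⊓ v` is `⊥`.
  obtain ⟨u, hu, huv⟩ := hφ.bot_mem_of_iInter_eq_empty hX
    (S := (fun u => u ⊓ v) '' (hφ.pointFilter p : Set K)) ⟨_, ⊤, htop, rfl⟩
    (by
      rintro _ ⟨a, ha, rfl⟩ _ ⟨b, hb, rfl⟩
      exact ⟨_, ⟨a ⊓ b, PFilter.inf_mem ha hb, rfl⟩, inf_le_inf_right _ inf_le_left,
        inf_le_inf_right _ inf_le_right⟩)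
    (by
      intro x
      by_cases hxp : p = x
      · exact ⟨_, ⟨⊤, htop, rfl⟩, fun h => hpv (hxp ▸ hφ.subset_iff.2 inf_le_right h)⟩
      · obtain ⟨a, hpa, hxa⟩ := hφ.exists_separating hX hxp
        exact ⟨_, ⟨a, hpa, rfl⟩, fun h => hxa (hφ.subset_iff.2 inf_le_left h)⟩)
  exact PFilter.eq_top_of_bot_mem (huv ▸ PFilter.inf_mem (hle hu) hv)

/-- The map of a Frinkian MOL-space into the Frink space of its MOL. -/
def toFrink (hφ : X.IsIsoOntoSCompactOpens φ) (hX : X.IsFrinkian) (p : P) : FrinkPoint K :=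
  ⟨hφ.pointFilter p, hφ.isCoatom_pointFilter hX p⟩

theorem mem_toFrink (hφ : X.IsIsoOntoSCompactOpens φ) (hX : X.IsFrinkian) {p : P} {a : K} :
    a ∈ (hφ.toFrink hX p).toSet ↔ p ∈ φ a := Iff.rfl

theorem toFrink_bijective (hφ : X.IsIsoOntoSCompactOpens φ) (hX : X.IsFrinkian) :
    Function.Bijective (hφ.toFrink hX) := by
  constructor
  · intro p q h
    by_contra hpq
    obtain ⟨a, hp, hq⟩ := hφ.exists_separating hX hpq
    rw [← hφ.mem_toFrink hX, ← h] at hq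
    exact hq hp
  · intro G
    -- A common point `x` gives an inclusion of `G` in the proper filter of `x`, which is an
    -- equality by maximality.
    have : ∃ x, ∀ a ∈ G.toSet, x ∈ φ a := by
      by_contra! hno
      exact G.bot_notMem (hφ.bot_mem_of_iInter_eq_empty hX (S := G.toSet) ⟨⊤, G.top_mem⟩
        (fun a ha b hb => ⟨a ⊓ b, FrinkPoint.inf_mem ha hb, inf_le_left, inf_le_right⟩) hno)
    obtain ⟨x, hx⟩ := this
    refine ⟨x, Subtype.ext ?_⟩
    exact (G.2.le_iff_eq (hφ.pointFilter_ne_top x)).1 hx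

theorem toFrink_coll_iff (hφ : X.IsIsoOntoSCompactOpens φ) (hX : X.IsFrinkian) (p q r : P) :
    X.Coll p q r ↔ FrinkPoint.Coll (hφ.toFrink hX p) (hφ.toFrink hX q) (hφ.toFrink hX r) := by
  have hproj := hX.molSpace.projective
  have hinj := (hφ.toFrink_bijective hX).1
  have hsub : ∀ a, X.IsSubspace (φ a) := fun a =>
    hX.molSpace.topology.isSubspace _ (hφ.mem_opens a)
  constructor
  · intro h
    have h' := hproj.rotate _ _ _ h
    have h'' := hproj.rotate _ _ _ h'
    refine ⟨hinj.ne (hproj.ne _ _ _ h), hinj.ne (hproj.ne _ _ _ h'').symm,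
      hinj.ne (hproj.ne _ _ _ h'), ?_, ?_⟩
    · ext a
      exact ⟨fun ha => ⟨ha.1, hsub a p ha.1 q ha.2 r h⟩,
        fun ha => ⟨ha.1, hsub a r ha.2 p ha.1 q h''⟩⟩
    · ext a
      exact ⟨fun ha => ⟨hsub a r ha.2 p ha.1 q h'', ha.2⟩,
        fun ha => ⟨hsub a q ha.1 r ha.2 p h', ha.2⟩⟩
  · rintro ⟨-, hpr, hqr, h, -⟩
    classical
    by_contra hn
    -- The join of two points is just their line, so `r` can be separated from `p` and `q`. An
    -- element `a ⊔ b` with image inside `V` then lies in the filters of `p` and `q` but not in that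
    -- of `r`.
    obtain ⟨U, -, V, hV, hrU, hpqV, hd⟩ := hX.stronglyHausdorff r {p, q} (by
      intro hr
      have hr' : r ∈ X.join {p} {q} := by
        rwa [Finset.coe_pair, ← Set.singleton_union] at hr
      rw [hproj.join_eq_lineJoin (hproj.isSubspace_singleton p) (hproj.isSubspace_singleton q)]
        at hr'
      rcases hr' with rfl | rfl | ⟨_, rfl, _, rfl, hcoll⟩
      · exact hpr rfl
      · exact hqr rfl
      · exact hn hcoll)
    obtain ⟨a, hpa, ha⟩ := hφ.exists_of_mem_opens hX.molSpace hV (p := p) (hpqV (by simp))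
    obtain ⟨b, hqb, hb⟩ := hφ.exists_of_mem_opens hX.molSpace hV (p := q) (hpqV (by simp))
    have hab : φ (a ⊔ b) ⊆ V := by
      rw [hφ.map_sup]
      exact join_subset (hX.molSpace.topology.isSubspace V hV) ha hb
    have hr := (h.subset (show a ⊔ b ∈ _ from
      ⟨hφ.subset_iff.2 le_sup_left hpa, hφ.subset_iff.2 le_sup_right hqb⟩)).2
    exact hd.subset ⟨hrU, hab hr⟩

theorem toFrink_orth_iff (hφ : X.IsIsoOntoSCompactOpens φ) (hX : X.IsFrinkian) (p q : P) :
    X.Orth p q ↔ FrinkPoint.Orth (hφ.toFrink hX p) (hφ.toFrink hX q) := by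
  constructor
  · intro h
    obtain ⟨U, hU, hc, hp, hq⟩ := hX.molSpace.sCompactOpens_basis.2.2 p q h
    obtain ⟨a, rfl⟩ := hφ.range_eq.superset ⟨hU, hc⟩
    rw [← hφ.map_compl] at hq
    exact ⟨a, hp, aᶜ, hq, (MOL.compl_compl a).ge⟩
  · rintro ⟨a, ha, b, hb, hab⟩
    have hp : p ∈ φ bᶜ := hφ.subset_iff.2 hab ha
    rw [hφ.map_compl] at hp
    exact hp q hb

theorem image_toFrink (hφ : X.IsIsoOntoSCompactOpens φ) (hX : X.IsFrinkian) (a : K) :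
    hφ.toFrink hX '' φ a = FrinkPoint.basic a := by
  apply Set.Subset.antisymm
  · rintro _ ⟨p, hp, rfl⟩
    exact hp
  · intro G hG
    obtain ⟨p, rfl⟩ := (hφ.toFrink_bijective hX).2 G
    exact ⟨p, hG, rfl⟩

theorem image_toFrink_span (hφ : X.IsIsoOntoSCompactOpens φ) (hX : X.IsFrinkian) (A : Set K) :
    hφ.toFrink hX '' X.span (⋃ a ∈ A, φ a) =
      collSpan FrinkPoint.Coll (⋃ a ∈ A, FrinkPoint.basic a) := by
  rw [span, image_collSpan (hφ.toFrink_bijective hX) (hφ.toFrink_coll_iff hX),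
    Set.image_iUnion₂]
  simp only [hφ.image_toFrink hX]

theorem isIso_toFrink (hφ : X.IsIsoOntoSCompactOpens φ) (hX : X.IsFrinkian) :
    X.IsIso (frinkSpace K) (hφ.toFrink hX) where
  bijective := hφ.toFrink_bijective hX
  coll_iff := hφ.toFrink_coll_iff hX
  orth_iff := hφ.toFrink_orth_iff hX
  open_iff U := by
    constructor
    · intro hU
      refine ⟨{a | φ a ⊆ U}, ?_⟩
      rw [← hφ.image_toFrink_span hX]
      congr 1
      apply Set.Subset.antisymm
      · intro p hp
        obtain ⟨a, hpa, ha⟩ := hφ.exists_of_mem_opens hX.molSpace hU hp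
        exact subset_collSpan _ (Set.mem_iUnion₂.2 ⟨a, ha, hpa⟩)
      · exact collSpan_subset (hX.molSpace.topology.isSubspace U hU)
          (Set.iUnion₂_subset fun a ha => ha)
    · rintro ⟨A, hA⟩
      rw [← hφ.image_toFrink_span hX] at hA
      rw [(hφ.toFrink_bijective hX).1.image_injective hA, ← Set.sUnion_image]
      refine hX.molSpace.topology.sSup_mem _ ?_
      rintro _ ⟨a, -, rfl⟩
      exact hφ.mem_opens a

end IsIsoOntoSCompactOpens

/-! ### Transport along isomorphisms of spaces. -/

namespace IsIso

variable {f : P → Q}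

theorem symm (h : X.IsIso Y f) :
    Y.IsIso X (Equiv.ofBijective f h.bijective).symm := by
  let e := Equiv.ofBijective f h.bijective
  have he : ∀ q, f (e.symm q) = q := e.apply_symm_apply
  refine ⟨e.symm.bijective, fun p q r => ?_, fun p q => ?_, fun U => ?_⟩
  · change _ ↔ X.Coll (e.symm p) (e.symm q) (e.symm r)
    rw [h.coll_iff, he, he, he]
  · change _ ↔ X.Orth (e.symm p) (e.symm q)
    rw [h.orth_iff, he, he]
  · change _ ↔ e.symm '' U ∈ X.opens
    rw [h.open_iff, Set.image_image]
    simp only [he, Set.image_id']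

theorem preimage_mem_opens_iff (h : X.IsIso Y f) {U : Set Q} :
    f ⁻¹' U ∈ X.opens ↔ U ∈ Y.opens := by
  rw [h.open_iff, Set.image_preimage_eq U h.bijective.2]

theorem isSCompact_image (h : X.IsIso Y f) {A : Set P} (hA : X.IsSCompact A) :
    Y.IsSCompact (f '' A) := by
  intro D hD hcov
  obtain ⟨_, ⟨V, hV, rfl⟩, hAV⟩ := hA ((f ⁻¹' ·) '' D)
    ⟨by
      rintro _ ⟨V, hV, rfl⟩
      exact h.preimage_mem_opens_iff.2 (hD.subset_opens hV), hD.nonempty.image _, by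
      rintro _ ⟨V, hV, rfl⟩ _ ⟨W, hW, rfl⟩
      obtain ⟨Z, hZ, h1, h2⟩ := hD.directed V hV W hW
      exact ⟨_, ⟨Z, hZ, rfl⟩, Set.preimage_mono h1, Set.preimage_mono h2⟩⟩
    (fun p hp => by
      obtain ⟨V, hV, hpV⟩ := hcov ⟨p, hp, rfl⟩
      exact ⟨_, ⟨V, hV, rfl⟩, hpV⟩)
  exact ⟨V, hV, Set.image_subset_iff.2 hAV⟩

theorem isSCompact_preimage (h : X.IsIso Y f) {A : Set Q} (hA : Y.IsSCompact A) :
    X.IsSCompact (f ⁻¹' A) := by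
  have := h.symm.isSCompact_image hA
  rwa [Equiv.image_symm_eq_preimage] at this

theorem isIsoOntoSCompactOpens_preimage (h : X.IsIso Y f) {φ : K → Set Q}
    (hφ : Y.IsIsoOntoSCompactOpens φ) : X.IsIsoOntoSCompactOpens fun a => f ⁻¹' φ a where
  injective a b hab := hφ.injective (h.bijective.2.preimage_injective hab)
  range_eq := by
    apply Set.Subset.antisymm
    · rintro _ ⟨a, rfl⟩
      obtain ⟨ho, hc⟩ := hφ.range_eq.subset ⟨a, rfl⟩
      exact ⟨h.preimage_mem_opens_iff.2 ho, h.isSCompact_preimage hc⟩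
    · rintro U ⟨ho, hc⟩
      obtain ⟨a, ha⟩ := hφ.range_eq.superset ⟨(h.open_iff U).1 ho, h.isSCompact_image hc⟩
      exact ⟨a, by simp only [ha, Set.preimage_image_eq U h.bijective.1]⟩
  map_bot := by simp [hφ.map_bot]
  map_top := by simp [hφ.map_top]
  map_inf a b := by simp [hφ.map_inf]
  map_sup a b := by
    apply h.bijective.1.image_injective
    simp only [hφ.map_sup, join, span]
    rw [image_collSpan h.bijective h.coll_iff, Set.image_union]
    simp only [Set.image_preimage_eq _ h.bijective.2]
  map_compl a := by
    ext q
    rw [hφ.map_compl]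
    refine ⟨fun hq p hp => (h.orth_iff q p).2 (hq _ hp), fun hq p hp => ?_⟩
    obtain ⟨p, rfl⟩ := h.bijective.2 p
    exact (h.orth_iff q p).1 (hq p hp)

end IsIso

end OrthoSpace

theorem theorem3p14 :
    -- the Frink space of an MOL is a Frinkian MOL-space with basis `U(a)`, and `a ↦ U(a)` is an
    -- isomorphism onto the algebra of its s-compact open subspaces
    (∀ (L : Type u) [MOL L],
      (frinkSpace L).IsFrinkian ∧
      (frinkSpace L).IsSBasis (Set.range (FrinkPoint.basic (L := L))) ∧
      (frinkSpace L).IsIsoOntoSCompactOpens (FrinkPoint.basic (L := L))) ∧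
    -- the s-compact open subspaces of a Frinkian MOL-space form an MOL, a subalgebra of the
    -- subspace lattice with `U ↦ Uᗮ`, and `p ↦ {U | p ∈ U}` is an isomorphism onto its Frink space
    (∀ (P : Type u) (X : OrthoSpace P), X.IsFrinkian →
      ∃ _ : MOL X.SCompactOpen,
        X.IsIsoOntoSCompactOpens (OrthoSpace.SCompactOpen.carrier (X := X)) ∧
        ∃ ψ : P → FrinkPoint X.SCompactOpen,
          (∀ p, (ψ p).toSet = {U | p ∈ U.carrier}) ∧ X.IsIso (frinkSpace X.SCompactOpen) ψ) ∧
    -- MOLs are isomorphic iff their Frink spaces are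
    (∀ (L K : Type u) [MOL L] [MOL K],
      MOLIsomorphic L K ↔ ∃ f, (frinkSpace L).IsIso (frinkSpace K) f) := by
  refine ⟨fun L _ => ⟨FrinkPoint.isFrinkian, FrinkPoint.isSBasis,
    FrinkPoint.isIsoOntoSCompactOpens⟩, fun P X hX => ?_, fun L K _ _ => ⟨?_, ?_⟩⟩
  · let _ := hX.molSpace.mol
    have hφ := hX.molSpace.isIsoOntoSCompactOpens_carrier
    exact ⟨hX.molSpace.mol, hφ, hφ.toFrink hX, fun _ => rfl, hφ.isIso_toFrink hX⟩
  · rintro ⟨e, he⟩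
    -- Along `e.symm` the Frink space of `L` represents `K` as well, so its canonical map lands in
    -- the Frink space of `K`.
    have hφ := (FrinkPoint.isIsoOntoSCompactOpens (L := L)).comp_orderIso e.symm fun a => by
      rw [e.symm_apply_eq, he, e.apply_symm_apply]
    exact ⟨_, hφ.isIso_toFrink FrinkPoint.isFrinkian⟩
  · rintro ⟨f, hf⟩
    -- Pulled back along `f`, both MOLs are the s-compact opens of the Frink space of `L`.
    exact FrinkPoint.isIsoOntoSCompactOpens.molIsomorphic
      (hf.isIsoOntoSCompactOpens_preimage FrinkPoint.isIsoOntoSCompactOpens)
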